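/- Fix a reference tetrahedron $\tilde e\subset\mathbb R^3$, an integer $p\ge 2$, and a finite-dimensional space $\tilde U=\mathcal P_p+\tilde U^+$ of polynomials on $\tilde e$, where $\tilde U^+\subset\mathcal P_{p'}$ for some $p'$ ($\mathcal P_m$ denotes the polynomials in three variables of total degree at most $m$). Let a quadrature rule on $\tilde e$ be given by a finite set of nodes $\tilde{\mathcal Q}\subset\tilde e$ and weights $\tilde\omega_{\tilde x}$, $\tilde x\in\tilde{\mathcal Q}$. Assume that all weights are strictly positive and that the rule is exact on $\mathcal P_{p-2}\otimes\tilde U$, i.e. $\int_{\tilde e} fg\,d\tilde x=\sum_{\tilde x\in\tilde{\mathcal Q}}\tilde\omega_{\tilde x}f(\tilde x)g(\tilde x)$ for all $f\in\mathcal P_{p-2}$ and $g\in\tilde U$. Let $\Omega\subset\mathbb R^3$ be a bounded open set (for instance a Lipschitz domain). Let $\mathcal T_h$ be a tessellation of $\Omega$ into finitely many nondegenerate tetrahedra: their interiors are pairwise disjoint and contained in $\Omega$, and the closed tetrahedra cover $\overline\Omega$. Let $h$ be the diameter of the smallest sphere that can contain each element, and suppose that $\mathcal T_h$ is shape regular with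 parameter $\sigma$: every element $e$ contains a ball of some diameter $d>0$ with $\operatorname{diam} e\le\sigma d$. For $e\in\mathcal T_h$ let $\phi_e:\tilde e\to e$ be the affine map taking the (numbered) vertices of $\tilde e$ to those of $e$, and put $$U(\mathcal T_h,\tilde U)=\{w\in H^1(\Omega): w\circ\phi_e\in\tilde U\text{ for all }e\in\mathcal T_h\},\qquad (u,w)_{\mathcal Q_h}=\sum_{e\in\mathcal T_h}\frac{|e|}{|\tilde e|}\sum_{\tilde x\in\tilde{\mathcal Q}}\tilde\omega_{\tilde x}\,u(\phi_e(\tilde x))\,w(\phi_e(\tilde x)),$$ where on each closed element the point values are those of the representative that is continuous on that element. Let $r_h(u,w)=\int_\Omega uw\,dx-(u,w)_{\mathcal Q_h}$ be the integration error of the mass matrix. Let $\|u\|_m^2=\sum_{|\alpha|\le m}\|D^\alpha u\|_{L^2(\Omega)}^2$ be the norm of $H^m(\Omega)$, and $\|w\|_{\mathcal T_h,2}^2=\sum_{e\in\mathcal T_h}\sum_{|\alpha|\le2}\|D^\alpha w\|_{L^2(e)}^2$ the broken $H^2$ norm. Then there is a constant $C>0$, depending only on $\tilde e$, $p$, $\tilde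 U$, the reference quadrature rule, $\Omega$ and $\sigma$, such that for every such tessellation $\mathcal T_h$, every integer $k\ge2$, every $u\in H^k(\Omega)$ and every $w\in U(\mathcal T_h,\tilde U)$ (in particular for every $w\in H^1_0(\Omega)\cap U(\mathcal T_h,\tilde U)$), $$|r_h(u,w)|\le C\,h^{\min(p,k)}\,\|u\|_{\min(p,k)}\,\|w\|_1\qquad\text{and}\qquad |r_h(u,w)|\le C\,h^{\min(p+1,k)}\,\|u\|_{\min(p+1,k)}\,\|w\|_{\mathcal T_h,2}.$$ -/

import Mathlib

open MeasureTheory Set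
open scoped ContDiff

noncomputable section

namespace MassLumping

/-- Three-dimensional Euclidean space. -/
abbrev E3 : Type := EuclideanSpace ℝ (Fin 3)

/-! ### Sobolev spaces -/

/-- The classical partial derivative in the coordinate direction `i`. -/
def partialDeriv (i : Fin 3) (f : E3 → ℝ) : E3 → ℝ :=
  fun x => fderiv ℝ f x (EuclideanSpace.single i 1)

/-- The classical derivative `D^α = ∂₁^{α₁} ∂₂^{α₂} ∂₃^{α₃}`. -/
def multiDeriv (α : Fin 3 → ℕ) (f : E3 → ℝ) : E3 → ℝ :=
  (partialDeriv 0)^[α 0] ((partialDeriv 1)^[α 1] ((partialDeriv 2)^[α 2] f))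

/-- `φ` is a smooth function with compact support in `Ω`. -/
def IsTestFunction (Ω : Set E3) (φ : E3 → ℝ) : Prop :=
  ContDiff ℝ ∞ φ ∧ HasCompactSupport φ ∧ tsupport φ ⊆ Ω

/-- `g` is the weak derivative `D^α u` on the open set `Ω`. -/
def IsWeakDeriv (Ω : Set E3) (α : Fin 3 → ℕ) (u g : E3 → ℝ) : Prop :=
  LocallyIntegrableOn u Ω ∧ LocallyIntegrableOn g Ω ∧
    ∀ φ : E3 → ℝ, IsTestFunction Ω φ →
      ∫ x in Ω, u x * multiDeriv α φ x = (-1) ^ (∑ i, α i) * ∫ x in Ω, g x * φ x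

open Classical in
/-- The weak derivative `D^α u` on `Ω` (unique almost everywhere in `Ω`); zero if there is none. -/
def weakDeriv (Ω : Set E3) (α : Fin 3 → ℕ) (u : E3 → ℝ) : E3 → ℝ :=
  if h : ∃ g, IsWeakDeriv Ω α u g then h.choose else 0

/-- The multi-indices of order at most `k`. -/
def multiIndices (k : ℕ) : Finset (Fin 3 → ℕ) :=
  (Fintype.piFinset fun _ => Finset.range (k + 1)).filter fun α => ∑ i, α i ≤ k

/-- `u ∈ H^k(Ω)`: all weak derivatives of order at most `k` (including `u` itself) exist and are
square integrable on `Ω`. -/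
def MemH (k : ℕ) (Ω : Set E3) (u : E3 → ℝ) : Prop :=
  ∀ α ∈ multiIndices k, ∃ g, IsWeakDeriv Ω α u g ∧ MemLp g 2 (volume.restrict Ω)

/-- The norm of `H^k(Ω)`: the square root of the sum of `‖D^α u‖²_{L²(Ω)}` over `|α| ≤ k`. -/
def sobolevNorm (k : ℕ) (Ω : Set E3) (u : E3 → ℝ) : ℝ :=
  Real.sqrt (∑ α ∈ multiIndices k, ∫ x in Ω, weakDeriv Ω α u x ^ 2)

/-! ### Tetrahedra and tetrahedral tessellations -/

/-- A nondegenerate tetrahedron, given by its four (numbered) affinely independent vertices. -/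
abbrev Tetrahedron : Type := AffineBasis (Fin 4) ℝ E3

/-- The tetrahedron as a closed set. -/
def Tetrahedron.closedCell (e : Tetrahedron) : Set E3 := convexHull ℝ (range e)

/-- The tetrahedron as an open set. -/
def Tetrahedron.openCell (e : Tetrahedron) : Set E3 := interior (Tetrahedron.closedCell e)

/-- The volume of a tetrahedron. -/
def Tetrahedron.vol (e : Tetrahedron) : ℝ := volume.real (Tetrahedron.closedCell e)

/-- The affine map taking the vertices of the reference tetrahedron `ref` to those of `e`: it sends
the point with barycentric coordinates `λ` in `ref` to the point with coordinates `λ` in `e`. -/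
def refMap (ref e : Tetrahedron) (x : E3) : E3 := ∑ i, ref.coord i x • e i

/-- `T` is a tetrahedral tessellation of the open set `Ω`: the open elements lie in `Ω` and are
pairwise disjoint, and the closed elements cover the closure of `Ω`. -/
structure IsTessellation (Ω : Set E3) (T : Finset Tetrahedron) : Prop where
  openCell_subset : ∀ e ∈ T, Tetrahedron.openCell e ⊆ Ω
  disjoint : ∀ e ∈ T, ∀ e' ∈ T, e ≠ e' →
    Disjoint (Tetrahedron.openCell e) (Tetrahedron.openCell e')
  cover : ⋃ e ∈ T, Tetrahedron.closedCell e = closure Ω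

/-- The mesh size `h`: the diameter of the smallest sphere that can contain each element. -/
def meshSize (T : Finset Tetrahedron) : ℝ :=
  sInf {d : ℝ | 0 ≤ d ∧ ∀ e ∈ T, ∃ c : E3,
    Tetrahedron.closedCell e ⊆ Metric.closedBall c (d / 2)}

/-- Mesh regularity with parameter `σ`: every element contains a ball whose diameter `d` satisfies
`diam e ≤ σ d`. -/
def IsShapeRegular (σ : ℝ) (T : Finset Tetrahedron) : Prop :=
  ∀ e ∈ T, ∃ (c : E3) (d : ℝ), 0 < d ∧
    Metric.closedBall c (d / 2) ⊆ Tetrahedron.closedCell e ∧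
    Metric.diam (Tetrahedron.closedCell e) ≤ σ * d

/-- The norm of the broken Sobolev space `H^k(T)`. -/
def brokenNorm (k : ℕ) (T : Finset Tetrahedron) (u : E3 → ℝ) : ℝ :=
  Real.sqrt (∑ e ∈ T, sobolevNorm k (Tetrahedron.openCell e) u ^ 2)

/-! ### The finite element space -/

/-- Polynomials in three variables. -/
abbrev Poly3 : Type := MvPolynomial (Fin 3) ℝ

/-- Evaluation of a polynomial at a point of space. -/
def polyEval (q : Poly3) (x : E3) : ℝ := MvPolynomial.eval (fun i => x i) q

/-- The space `P_m` of polynomials of total degree at most `m`. -/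
def polySpace (m : ℕ) : Submodule ℝ Poly3 := MvPolynomial.restrictTotalDegree (Fin 3) ℝ m

/-- The finite element space `U(T, Ũ)`: the functions `w ∈ H¹(Ω)` for which `w ∘ φ_e`, restricted
to the reference element, belongs to `Ũ` for every element `e` of the mesh. -/
def MemFESpace (ref : Tetrahedron) (U : Submodule ℝ Poly3) (Ω : Set E3) (T : Finset Tetrahedron)
    (w : E3 → ℝ) : Prop :=
  MemH 1 Ω w ∧ ∀ e ∈ T, ∃ q ∈ U,
    ∀ᵐ x ∂(volume.restrict (Tetrahedron.openCell ref)), w (refMap ref e x) = polyEval q x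

/-! ### Quadrature -/

/-- The quadrature rule on the reference element with nodes `Q` and weights `wt` is exact for all
products of an element of `V` and an element of `U`. -/
def IsExactOnProducts (ref : Tetrahedron) (Q : Finset E3) (wt : E3 → ℝ)
    (V U : Submodule ℝ Poly3) : Prop :=
  ∀ f ∈ V, ∀ g ∈ U,
    ∫ x in Tetrahedron.closedCell ref, polyEval f x * polyEval g x =
      ∑ x ∈ Q, wt x * (polyEval f x * polyEval g x)

open Classical in
/-- The representative of `u` that is continuous on the closed element `e` (its values on the
closed element are unique); `u` itself if there is none. -/
def contRep (e : Tetrahedron) (u : E3 → ℝ) : E3 → ℝ :=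
  if h : ∃ v : E3 → ℝ, ContinuousOn v (Tetrahedron.closedCell e) ∧
      v =ᵐ[volume.restrict (Tetrahedron.openCell e)] u
  then h.choose else u

/-- The discrete product `(u, w)_{Q_h}`: on each element `e` the nodes are the images of the
reference nodes and the weights are `|e| / |ẽ|` times the reference weights. -/
def discreteInner (ref : Tetrahedron) (Q : Finset E3) (wt : E3 → ℝ) (T : Finset Tetrahedron)
    (u w : E3 → ℝ) : ℝ :=
  ∑ e ∈ T, Tetrahedron.vol e / Tetrahedron.vol ref *
    ∑ x ∈ Q, wt x * (contRep e u (refMap ref e x) * contRep e w (refMap ref e x))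

/-- The integration error `r_h(u, w) = (u, w) - (u, w)_{Q_h}` of the mass matrix. -/
def integrationError (ref : Tetrahedron) (Q : Finset E3) (wt : E3 → ℝ) (Ω : Set E3)
    (T : Finset Tetrahedron) (u w : E3 → ℝ) : ℝ :=
  (∫ x in Ω, u x * w x) - discreteInner ref Q wt T u w

end MassLumping

end

noncomputable section

namespace MassLumping

/-! ### Calculus of classical partial derivatives -/

/-! The integration error is a sum of local errors E_e(u, W), where W is the polynomial that equals
w on e. Exactness makes E_e(f, g) vanish in two situations: when f has degree at most p - 2 and g
pulls back into Ũ; and, since 1 lies in P_(p-2) and P_p in Ũ, when f and g are polynomials whose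
degrees add up to at most p (`cellError_eq_zero_of_degree`). So the lower the degree of the second
argument, the more polynomials may be subtracted from the first. Expand W about a point of e. Its
constant part, linear part and remainder are of size 1, h and h², and the errors against them vanish
for u of degree m - 1, m - 2 and m - 3, which gains h^m, h^(m-1) and h^(m-2). Each product is h^m,
for m up to p + 1. With only H¹ control of w the expansion stops at the constant part, and m is at
most p.

The gain is a Bramble-Hilbert argument with explicit constants (`abs_cellError_le_of_contDiff`):
subtract from u its Taylor polynomial at y and average over y in e. At every x in e, quadrature
nodes included, the averaged remainder is bounded by the H^m norm. Contracting e towards x costs (1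
- s)^(-3/2) after Cauchy-Schwarz, against a factor 1 - s in the Taylor remainder, and (1 - s)^(-1/2)
is integrable: this is where dimension three and m ≥ 2 meet (`integral_taylor_kernel_le`). With
nothing subtracted, the same estimate is the Sobolev inequality that gives point values of u a
meaning. Contraction followed by mollification carries everything from smooth functions to H^m
(`MemH.exists_smooth_approx`, `abs_cellError_le`).

The sup norms of W and its derivatives become L² norms by an inverse inequality that is affine
invariant up to |e|^(1/2) (`exists_inverse_inequality`); this factor cancels against the |e|^(1/2)
left by the averaging. Cauchy-Schwarz over the elements then gives the global estimates. -/

lemma contDiff_partialDeriv {f : E3 → ℝ} (hf : ContDiff ℝ ∞ f) (i : Fin 3) :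
    ContDiff ℝ ∞ (partialDeriv i f) :=
  (hf.fderiv_right (m := ∞) (by simp)).clm_apply contDiff_const

lemma partialDeriv_comm {f : E3 → ℝ} (hf : ContDiff ℝ ∞ f) (i j : Fin 3) :
    partialDeriv i (partialDeriv j f) = partialDeriv j (partialDeriv i f) := by
  have key : ∀ a b : Fin 3, ∀ x, partialDeriv a (partialDeriv b f) x =
      fderiv ℝ (fderiv ℝ f) x (EuclideanSpace.single a 1) (EuclideanSpace.single b 1) := by
    intro a b x
    have hd : DifferentiableAt ℝ (fderiv ℝ f) x :=
      ((hf.fderiv_right (m := ∞) (by simp)).differentiable (by simp)) x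
    have he : partialDeriv b f = fun y => fderiv ℝ f y (EuclideanSpace.single b 1) := rfl
    rw [he, partialDeriv, fderiv_clm_apply hd (differentiableAt_const _)]
    simp
  funext x
  rw [key, key]
  exact ((contDiff_infty.1 hf 2).contDiffAt.isSymmSndFDerivAt (by simp)).eq _ _

lemma contDiff_iterate_partialDeriv (i : Fin 3) (n : ℕ) {f : E3 → ℝ} (hf : ContDiff ℝ ∞ f) :
    ContDiff ℝ ∞ ((partialDeriv i)^[n] f) := by
  induction n generalizing f with
  | zero => exact hf
  | succ n ih => exact ih (contDiff_partialDeriv hf i)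

lemma contDiff_multiDeriv (α : Fin 3 → ℕ) {f : E3 → ℝ} (hf : ContDiff ℝ ∞ f) :
    ContDiff ℝ ∞ (multiDeriv α f) :=
  contDiff_iterate_partialDeriv _ _ (contDiff_iterate_partialDeriv _ _
    (contDiff_iterate_partialDeriv _ _ hf))

lemma iterate_partialDeriv_comm (i j : Fin 3) (n : ℕ) {f : E3 → ℝ} (hf : ContDiff ℝ ∞ f) :
    (partialDeriv i)^[n] (partialDeriv j f) = partialDeriv j ((partialDeriv i)^[n] f) := by
  induction n generalizing f with
  | zero => rfl
  | succ n ih =>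
    simp only [Function.iterate_succ, Function.comp]
    rw [partialDeriv_comm hf, ih (contDiff_partialDeriv hf i)]

lemma multiDeriv_zero (f : E3 → ℝ) : multiDeriv 0 f = f := rfl

lemma multiDeriv_add_single (α : Fin 3 → ℕ) (k : Fin 3) {f : E3 → ℝ} (hf : ContDiff ℝ ∞ f) :
    multiDeriv (α + Pi.single k 1) f = partialDeriv k (multiDeriv α f) := by
  have h1 := contDiff_iterate_partialDeriv 2 (α 2) hf
  have h2 := contDiff_iterate_partialDeriv 1 (α 1) h1
  unfold multiDeriv
  fin_cases k
  · simp [Function.iterate_succ_apply']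
  · simp [Function.iterate_succ_apply']
    exact iterate_partialDeriv_comm 0 1 _ h2
  · simp [Function.iterate_succ_apply']
    rw [iterate_partialDeriv_comm 1 2 _ h1, iterate_partialDeriv_comm 0 2 _ h2]

/-- Integration by parts takes the outermost derivative of f but needs the innermost one on the test
function, hence both forms of the recursion. -/
lemma multiDeriv_add_single' (α : Fin 3 → ℕ) (k : Fin 3) {f : E3 → ℝ} (hf : ContDiff ℝ ∞ f) :
    multiDeriv (α + Pi.single k 1) f = multiDeriv α (partialDeriv k f) := by
  rw [multiDeriv_add_single α k hf]
  have h1 := contDiff_iterate_partialDeriv 2 (α 2) hf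
  have h2 := contDiff_iterate_partialDeriv 1 (α 1) h1
  unfold multiDeriv
  rw [← iterate_partialDeriv_comm 0 k _ h2, ← iterate_partialDeriv_comm 1 k _ h1,
    ← iterate_partialDeriv_comm 2 k _ hf]

/-- Induction on the order |α|: a nonzero multi-index has a component that can be lowered by one. -/
lemma multiIndex_induction {P : (Fin 3 → ℕ) → Prop} (h0 : P 0)
    (hs : ∀ α k, P α → P (α + Pi.single k 1)) (α : Fin 3 → ℕ) : P α := by
  induction hn : ∑ i, α i generalizing α with
  | zero =>
    have : α = 0 := by funext i; simpa using (Finset.sum_eq_zero_iff.1 hn) i (Finset.mem_univ i)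
    rw [this]; exact h0
  | succ n ih =>
    obtain ⟨k, hk⟩ : ∃ k, α k ≠ 0 := by
      by_contra h
      push Not at h
      simp [h] at hn
    have e : α - Pi.single k 1 + Pi.single k 1 = α := by
      funext i
      by_cases hi : i = k
      · subst hi; simp; omega
      · simp [hi]
    rw [← e]
    apply hs
    apply ih
    have := congrArg (fun β : Fin 3 → ℕ => ∑ i, β i) e
    simp only [Pi.add_apply, Finset.sum_add_distrib] at this
    rw [Finset.sum_pi_single' k 1] at this
    simp at this
    simp only [Pi.sub_apply]
    omega

lemma sum_add_single (α : Fin 3 → ℕ) (k : Fin 3) :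
    ∑ i, (α + Pi.single k 1 : Fin 3 → ℕ) i = ∑ i, α i + 1 := by
  simp [Finset.sum_add_distrib]

lemma mem_multiIndices {k : ℕ} {α : Fin 3 → ℕ} : α ∈ multiIndices k ↔ ∑ i, α i ≤ k := by
  simp only [multiIndices, Finset.mem_filter, Fintype.mem_piFinset, Finset.mem_range,
    and_iff_right_iff_imp]
  intro h i
  have := Finset.single_le_sum (f := α) (fun _ _ => Nat.zero_le _) (Finset.mem_univ i)
  omega

lemma partialDeriv_add {f g : E3 → ℝ} (hf : ContDiff ℝ ∞ f) (hg : ContDiff ℝ ∞ g) (i : Fin 3) :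
    partialDeriv i (f + g) = partialDeriv i f + partialDeriv i g := by
  funext x
  simp only [partialDeriv, Pi.add_apply]
  rw [fderiv_add (hf.differentiable (by simp) x) (hg.differentiable (by simp) x)]
  rfl

lemma partialDeriv_const_mul {f : E3 → ℝ} (hf : ContDiff ℝ ∞ f) (c : ℝ) (i : Fin 3) :
    partialDeriv i (fun x => c * f x) = fun x => c * partialDeriv i f x := by
  funext x
  simp only [partialDeriv]
  rw [fderiv_const_mul (hf.differentiable (by simp) x)]
  rfl

lemma multiDeriv_const_mul (α : Fin 3 → ℕ) {f : E3 → ℝ} (hf : ContDiff ℝ ∞ f) (c : ℝ) :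
    multiDeriv α (fun x => c * f x) = fun x => c * multiDeriv α f x := by
  induction α using multiIndex_induction with
  | h0 => rfl
  | hs α k ih =>
    rw [multiDeriv_add_single _ _ hf, multiDeriv_add_single _ _ (contDiff_const.mul hf), ih,
      partialDeriv_const_mul (contDiff_multiDeriv α hf)]

lemma multiDeriv_add (α : Fin 3 → ℕ) {f g : E3 → ℝ} (hf : ContDiff ℝ ∞ f)
    (hg : ContDiff ℝ ∞ g) : multiDeriv α (f + g) = multiDeriv α f + multiDeriv α g := by
  induction α using multiIndex_induction with
  | h0 => rfl
  | hs α k ih =>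
    rw [multiDeriv_add_single _ _ hf, multiDeriv_add_single _ _ hg,
      multiDeriv_add_single (f := f + g) _ _ (hf.add hg), ih,
      partialDeriv_add (contDiff_multiDeriv α hf) (contDiff_multiDeriv α hg)]

lemma multiDeriv_sub (α : Fin 3 → ℕ) {f g : E3 → ℝ} (hf : ContDiff ℝ ∞ f)
    (hg : ContDiff ℝ ∞ g) : multiDeriv α (f - g) = multiDeriv α f - multiDeriv α g := by
  have h : f - g = f + fun x => (-1) * g x := by funext x; simp [sub_eq_add_neg]
  rw [h, multiDeriv_add α hf (contDiff_const.mul hg), multiDeriv_const_mul α hg]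
  funext x; simp [sub_eq_add_neg]

/-- Needed both for the contraction in the smoothing and, with t = -1, for the reflected mollifier y
↦ η(z - y). -/
lemma multiDeriv_comp_dilation (α : Fin 3 → ℕ) {f : E3 → ℝ} (hf : ContDiff ℝ ∞ f) (a : E3)
    (t : ℝ) : multiDeriv α (fun x => f (a + t • x)) =
      fun x => t ^ (∑ i, α i) * multiDeriv α f (a + t • x) := by
  have hd : ContDiff ℝ ∞ (fun x : E3 => a + t • x) := contDiff_const.add (contDiff_const_smul t)
  induction α using multiIndex_induction with
  | h0 => simp [multiDeriv_zero]
  | hs α k ih =>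
    have hα := contDiff_multiDeriv α hf
    rw [multiDeriv_add_single _ _ hf, multiDeriv_add_single (f := fun x => f (a + t • x)) _ _ (hf.comp hd), ih,
      partialDeriv_const_mul (f := fun x => multiDeriv α f (a + t • x)) (hα.comp hd), sum_add_single]
    funext x
    have h1 : HasFDerivAt (fun x : E3 => a + t • x) (t • ContinuousLinearMap.id ℝ E3) x :=
      ((hasFDerivAt_id x).const_smul t).const_add a
    have h2 := (hα.differentiable (by simp) (a + t • x)).hasFDerivAt.comp x h1
    simp only [partialDeriv]
    rw [show (fun x => multiDeriv α f (a + t • x)) =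
      multiDeriv α f ∘ fun x => a + t • x from rfl, h2.fderiv]
    simp
    ring

/-! ### Taylor expansion -/

/-- The `i`-th derivative of `f` at `y` in the direction `v`, that is `(v · ∇)^i f (y)`. -/
def dirPow : ℕ → (E3 → ℝ) → E3 → E3 → ℝ
  | 0, f, y, _ => f y
  | i + 1, f, y, v => ∑ k, v k * dirPow i (partialDeriv k f) y v

/-- The Taylor polynomial of degree less than `j` of `f` at `y`, evaluated at `y + v`. -/
def taylorSum (j : ℕ) (f : E3 → ℝ) (y v : E3) : ℝ :=
  ∑ i ∈ Finset.range j, dirPow i f y v / (i.factorial : ℝ)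

/-- The sum of the absolute values of all derivatives of order at most `m`. -/
def derivSum (m : ℕ) (f : E3 → ℝ) (y : E3) : ℝ := ∑ α ∈ multiIndices m, |multiDeriv α f y|

lemma continuous_dirPow (i : ℕ) {f : E3 → ℝ} (hf : ContDiff ℝ ∞ f) :
    Continuous fun z : E3 × E3 => dirPow i f z.1 z.2 := by
  induction i generalizing f with
  | zero => exact hf.continuous.comp continuous_fst
  | succ i ih =>
    simp only [dirPow]
    refine continuous_finsetSum _ fun k _ => Continuous.mul ?_ (ih (contDiff_partialDeriv hf k))
    fun_prop

lemma continuous_taylorSum (j : ℕ) {f : E3 → ℝ} (hf : ContDiff ℝ ∞ f) :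
    Continuous fun z : E3 × E3 => taylorSum j f z.1 z.2 :=
  continuous_finsetSum _ fun i _ => (continuous_dirPow i hf).div_const _

lemma continuous_derivSum (m : ℕ) {f : E3 → ℝ} (hf : ContDiff ℝ ∞ f) :
    Continuous (derivSum m f) :=
  continuous_finsetSum _ fun α _ => (contDiff_multiDeriv α hf).continuous.abs

lemma derivSum_nonneg (m : ℕ) (f : E3 → ℝ) (y : E3) : 0 ≤ derivSum m f y :=
  Finset.sum_nonneg fun _ _ => abs_nonneg _

lemma E3.eq_sum_single (v : E3) : v = ∑ k, v k • EuclideanSpace.single k (1 : ℝ) := by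
  ext i
  simp [Fin.sum_univ_three]
  fin_cases i <;> simp

lemma fderiv_apply_eq_sum (f : E3 → ℝ) (y v : E3) :
    fderiv ℝ f y v = ∑ k, v k * partialDeriv k f y := by
  conv_lhs => rw [E3.eq_sum_single v]
  simp [partialDeriv]

lemma hasDerivAt_dirPow (i : ℕ) {f : E3 → ℝ} (hf : ContDiff ℝ ∞ f) (y v : E3) (s : ℝ) :
    HasDerivAt (fun s : ℝ => dirPow i f (y + s • v) v) (dirPow (i + 1) f (y + s • v) v) s := by
  induction i generalizing f with
  | zero =>
    have h1 : HasDerivAt (fun s : ℝ => y + s • v) v s := by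
      simpa using ((hasDerivAt_id s).smul_const v).const_add y
    have h2 := (hf.differentiable (by simp) (y + s • v)).hasFDerivAt.comp_hasDerivAt s h1
    rw [fderiv_apply_eq_sum] at h2
    exact h2
  | succ i ih =>
    have : ∀ g, dirPow (i + 1 + 1) g (y + s • v) v =
      ∑ k, v k * dirPow (i + 1) (partialDeriv k g) (y + s • v) v := fun _ => rfl
    rw [this]
    exact HasDerivAt.fun_sum fun k _ => (ih (contDiff_partialDeriv hf k)).const_mul _

lemma E3.abs_apply_le (v : E3) (k : Fin 3) : |v k| ≤ ‖v‖ := by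
  simpa using PiLp.norm_apply_le v k

/-- Each directional derivative is a sum of three terms weighted by |v k| ≤ ‖v‖, hence the factor
3‖v‖. The index β records the derivatives already taken, so that the induction closes. -/
lemma abs_dirPow_le {m i : ℕ} {β : Fin 3 → ℕ} (h : ∑ k, β k + i ≤ m) {f : E3 → ℝ}
    (hf : ContDiff ℝ ∞ f) (y v : E3) :
    |dirPow i (multiDeriv β f) y v| ≤ (3 * ‖v‖) ^ i * derivSum m f y := by
  induction i generalizing β with
  | zero =>
    simp only [dirPow, pow_zero, one_mul]
    exact Finset.single_le_sum (f := fun α => |multiDeriv α f y|) (fun _ _ => abs_nonneg _)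
      (mem_multiIndices.2 (by omega))
  | succ i ih =>
    simp only [dirPow]
    calc |∑ k, v k * dirPow i (partialDeriv k (multiDeriv β f)) y v|
        ≤ ∑ k : Fin 3, |v k * dirPow i (partialDeriv k (multiDeriv β f)) y v| :=
          Finset.abs_sum_le_sum_abs _ _
      _ ≤ ∑ k : Fin 3, ‖v‖ * ((3 * ‖v‖) ^ i * derivSum m f y) := by
          refine Finset.sum_le_sum fun k _ => ?_
          rw [abs_mul, ← multiDeriv_add_single β k hf]
          refine mul_le_mul (E3.abs_apply_le v k) (ih ?_) (abs_nonneg _) (norm_nonneg _)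
          rw [sum_add_single]; omega
      _ = _ := by simp; ring

/-- The sum is the Taylor polynomial based at the moving point y + s v and evaluated at y + v.
Differentiating in s telescopes and leaves only the top term. -/
lemma hasDerivAt_taylor_aux (m : ℕ) {f : E3 → ℝ} (hf : ContDiff ℝ ∞ f) (y v : E3) (s : ℝ) :
    HasDerivAt (fun s : ℝ => ∑ i ∈ Finset.range (m + 1),
        (1 - s) ^ i * (dirPow i f (y + s • v) v / (i.factorial : ℝ)))
      ((1 - s) ^ m * (dirPow (m + 1) f (y + s • v) v / (m.factorial : ℝ))) s := by
  induction m with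
  | zero => simpa using hasDerivAt_dirPow 0 hf y v s
  | succ m ih =>
    simp_rw [Finset.sum_range_succ _ (m + 1)]
    have h1 : HasDerivAt (fun s : ℝ => (1 - s) ^ (m + 1)) (-((m + 1 : ℝ) * (1 - s) ^ m)) s := by
      have := ((hasDerivAt_id s).const_sub 1).fun_pow (m + 1)
      simpa using this
    have h2 := ih.fun_add (h1.fun_mul ((hasDerivAt_dirPow (m + 1) hf y v s).div_const
      ((m + 1).factorial : ℝ)))
    refine h2.congr_deriv ?_
    have : (m.factorial : ℝ) ≠ 0 := by positivity
    rw [Nat.factorial_succ]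
    push_cast
    field_simp
    ring

lemma sub_taylorSum_eq_integral (m : ℕ) {f : E3 → ℝ} (hf : ContDiff ℝ ∞ f) (y v : E3) :
    f (y + v) - taylorSum (m + 1) f y v =
      ∫ s in (0 : ℝ)..1, (1 - s) ^ m * (dirPow (m + 1) f (y + s • v) v / (m.factorial : ℝ)) := by
  have hc : Continuous fun s : ℝ =>
      (1 - s) ^ m * (dirPow (m + 1) f (y + s • v) v / (m.factorial : ℝ)) := by
    refine Continuous.mul (by fun_prop) (Continuous.div_const ?_ _)
    exact (continuous_dirPow (m + 1) hf).comp (f := fun s : ℝ => (y + s • v, v)) (by fun_prop)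
  rw [intervalIntegral.integral_eq_sub_of_hasDerivAt
    (fun s _ => hasDerivAt_taylor_aux m hf y v s) (hc.intervalIntegrable _ _)]
  congr 1
  · rw [Finset.sum_eq_single 0]
    · simp [dirPow]
    · intro i _ hi; simp [hi]
    · simp
  · simp [taylorSum]

/-- The integral remainder carries (1 - s)^(m-1). One factor 1 - s, available since m ≥ 2, suffices
to absorb the singularity met later in `integral_taylor_kernel_le`. -/
lemma abs_sub_taylorSum_le {m : ℕ} (hm : 2 ≤ m) {f : E3 → ℝ} (hf : ContDiff ℝ ∞ f) (y v : E3) :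
    |f (y + v) - taylorSum m f y v| ≤
      (3 * ‖v‖) ^ m * ∫ s in (0 : ℝ)..1, (1 - s) * derivSum m f (y + s • v) := by
  obtain ⟨n, rfl⟩ : ∃ n, m = n + 1 + 1 := ⟨m - 2, by omega⟩
  rw [sub_taylorSum_eq_integral _ hf, ← intervalIntegral.integral_const_mul]
  have hc : Continuous fun s : ℝ => derivSum (n + 1 + 1) f (y + s • v) :=
    (continuous_derivSum _ hf).comp (by fun_prop)
  rw [← Real.norm_eq_abs]
  refine intervalIntegral.norm_integral_le_of_norm_le zero_le_one ?_
    (Continuous.intervalIntegrable (by fun_prop) _ _)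
  refine Filter.Eventually.of_forall fun s hs => ?_
  have h0 : 0 ≤ 1 - s := by linarith [hs.2]
  have h1 : 1 - s ≤ 1 := by linarith [hs.1]
  have hb := abs_dirPow_le (m := n + 1 + 1) (i := n + 1 + 1) (β := 0) (by simp) hf (y + s • v) v
  rw [multiDeriv_zero] at hb
  rw [Real.norm_eq_abs, abs_mul, abs_div, Nat.abs_cast, abs_of_nonneg (pow_nonneg h0 _)]
  have h2 : |dirPow (n + 1 + 1) f (y + s • v) v| / ((n + 1).factorial : ℝ) ≤
      |dirPow (n + 1 + 1) f (y + s • v) v| :=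
    div_le_self (abs_nonneg _) (by exact_mod_cast Nat.one_le_iff_ne_zero.2 (Nat.factorial_ne_zero _))
  have h3 : (1 - s) ^ (n + 1) ≤ 1 - s := by
    rw [pow_succ]; exact mul_le_of_le_one_left h0 (pow_le_one₀ h0 h1)
  calc _ ≤ (1 - s) * ((3 * ‖v‖) ^ (n + 1 + 1) * derivSum (n + 1 + 1) f (y + s • v)) :=
        mul_le_mul h3 (h2.trans hb) (by positivity) h0
    _ = _ := by ring

/-! ### The averaged Taylor remainder -/

/-- Weighted Cauchy-Schwarz: the quadratic t ↦ ∫ ρ (F - t)² is nonnegative, so its discriminant is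
not positive. It serves with ρ = 1 on a cell and with ρ a mollifier. -/
lemma sq_integral_mul_le {X : Type*} [MeasurableSpace X] {μ : Measure X} {ρ F : X → ℝ}
    (h0 : ∀ x, 0 ≤ ρ x) (hρ : Integrable ρ μ) (hF : Integrable (fun x => ρ x * F x) μ)
    (hF2 : Integrable (fun x => ρ x * F x ^ 2) μ) :
    (∫ x, ρ x * F x ∂μ) ^ 2 ≤ (∫ x, ρ x ∂μ) * ∫ x, ρ x * F x ^ 2 ∂μ := by
  set M := ∫ x, ρ x ∂μ with hM
  set I := ∫ x, ρ x * F x ∂μ with hI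
  set J := ∫ x, ρ x * F x ^ 2 ∂μ with hJ
  have key : ∀ t : ℝ, 0 ≤ M * (t * t) + (-2 * I) * t + J := by
    intro t
    have h : 0 ≤ ∫ x, ρ x * (F x - t) ^ 2 ∂μ :=
      integral_nonneg fun x => mul_nonneg (h0 x) (sq_nonneg _)
    have e : ∫ x, ρ x * (F x - t) ^ 2 ∂μ = J - 2 * t * I + t ^ 2 * M := by
      rw [hJ, hI, hM, ← integral_const_mul, ← integral_const_mul, ← integral_sub hF2 (hF.const_mul _),
        ← integral_add (f := fun x => ρ x * F x ^ 2 - 2 * t * (ρ x * F x))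
          (hF2.sub (hF.const_mul _)) (hρ.const_mul _)]
      congr 1; funext x; ring
    rw [e] at h; linarith
  have := discrim_le_zero key
  rw [discrim] at this
  nlinarith

lemma sq_setIntegral_le {K : Set E3} (hK : IsCompact K) {F : E3 → ℝ} (hF : Continuous F) :
    (∫ x in K, F x) ^ 2 ≤ volume.real K * ∫ x in K, F x ^ 2 := by
  have hc : ∀ G : E3 → ℝ, Continuous G → Integrable G (volume.restrict K) := fun G hG =>
    hG.continuousOn.integrableOn_compact hK
  have h := sq_integral_mul_le (μ := volume.restrict K) (ρ := fun _ => 1) (F := F)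
    (fun _ => zero_le_one) (hc _ continuous_const) (by simpa using hc _ hF)
    (by simpa using hc (fun x => F x ^ 2) (hF.pow 2))
  simpa using h

lemma integral_comp_affine (G : E3 → ℝ) {a : ℝ} (ha : 0 < a) (b : E3) :
    ∫ y, G (b + a • y) = a⁻¹ ^ 3 * ∫ y, G y := by
  rw [Measure.integral_comp_smul_of_nonneg volume (fun y => G (b + y)) a (hR := ha.le),
    integral_add_left_eq_self G b]
  simp

/-- The contraction towards x maps the convex set K into itself, and its Jacobian is (1 - s)³. -/
lemma setIntegral_comp_contraction_le {K : Set E3} (hK : IsCompact K) (hKc : Convex ℝ K) {x : E3}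
    (hx : x ∈ K) {G : E3 → ℝ} (hG : Continuous G) (h0 : ∀ y, 0 ≤ G y) {s : ℝ} (hs0 : 0 ≤ s)
    (hs1 : s < 1) :
    ∫ y in K, G (s • x + (1 - s) • y) ≤ (1 - s)⁻¹ ^ 3 * ∫ y in K, G y := by
  have hm := hK.measurableSet
  have ha : 0 < 1 - s := by linarith
  rw [← integral_indicator hm, ← integral_indicator hm, ← integral_comp_affine _ ha (s • x)]
  have hi : Integrable (K.indicator G) := (hG.continuousOn.integrableOn_compact hK).integrable_indicator hm
  refine integral_mono ?_ ?_ ?_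
  · refine IntegrableOn.integrable_indicator ?_ hm
    exact (Continuous.continuousOn (by fun_prop)).integrableOn_compact hK
  · have := (hi.comp_add_left (s • x)).comp_smul ha.ne'
    exact this
  · intro y
    by_cases hy : y ∈ K
    · have : s • x + (1 - s) • y ∈ K := hKc hx hy hs0 ha.le (by ring)
      simp [hy, this]
    · simp only [indicator_of_notMem hy]
      exact indicator_nonneg (fun z _ => h0 z) _

/-- By Fubini the y-integral is done first, at fixed s. Cauchy-Schwarz and the substitution z = s x
+ (1 - s) y bound it by (1 - s)(1 - s)^(-3/2) |K|^(1/2) ‖G‖. The remaining power (1 - s)^(-1/2) has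
integral 2. -/
lemma integral_taylor_kernel_le {K : Set E3} (hK : IsCompact K) (hKc : Convex ℝ K) {x : E3}
    (hx : x ∈ K) {G : E3 → ℝ} (hG : Continuous G) :
    ∫ y in K, ∫ s in (0 : ℝ)..1, (1 - s) * G (y + s • (x - y)) ≤
      2 * (Real.sqrt (volume.real K) * Real.sqrt (∫ y in K, G y ^ 2)) := by
  set B := Real.sqrt (volume.real K) * Real.sqrt (∫ y in K, G y ^ 2) with hB
  have hcont : Continuous fun z : E3 × ℝ => (1 - z.2) * G (z.1 + z.2 • (x - z.1)) := by fun_prop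
  have hswap : ∫ y in K, ∫ s in (0 : ℝ)..1, (1 - s) * G (y + s • (x - y)) =
      ∫ s in (0 : ℝ)..1, ∫ y in K, (1 - s) * G (y + s • (x - y)) := by
    simp_rw [intervalIntegral.integral_of_le zero_le_one, ← integral_Icc_eq_integral_Ioc]
    refine integral_integral_swap (f := fun y s => (1 - s) * G (y + s • (x - y))) ?_
    rw [Measure.prod_restrict]
    exact hcont.continuousOn.integrableOn_compact (hK.prod isCompact_Icc)
  rw [hswap]
  have hle : ∀ s ∈ Ioo (0 : ℝ) 1, ∫ y in K, (1 - s) * G (y + s • (x - y)) ≤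
      (1 - s) ^ (-(1 / 2) : ℝ) * B := by
    intro s hs
    have ha : 0 < 1 - s := by linarith [hs.2]
    have e1 : ∀ y, y + s • (x - y) = s • x + (1 - s) • y := fun y => by module
    simp_rw [e1]
    rw [integral_const_mul]
    have hcs := sq_setIntegral_le hK (F := fun y => G (s • x + (1 - s) • y)) (by fun_prop)
    have hct := setIntegral_comp_contraction_le hK hKc hx (hG.pow 2) (fun y => sq_nonneg _)
      hs.1.le hs.2
    have hJ : 0 ≤ ∫ y in K, G y ^ 2 := integral_nonneg fun y => sq_nonneg _
    have hexp : ((1 - s) ^ (-(1 / 2) : ℝ)) ^ 2 = (1 - s)⁻¹ := by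
      rw [← Real.rpow_natCast, ← Real.rpow_mul ha.le]
      norm_num [Real.rpow_neg_one]
    refine (le_abs_self _).trans (abs_le_of_sq_le_sq ?_ (by positivity))
    calc ((1 - s) * ∫ y in K, G (s • x + (1 - s) • y)) ^ 2
        = (1 - s) ^ 2 * (∫ y in K, G (s • x + (1 - s) • y)) ^ 2 := by ring
      _ ≤ (1 - s) ^ 2 * (volume.real K * ((1 - s)⁻¹ ^ 3 * ∫ y in K, G y ^ 2)) := by
          refine mul_le_mul_of_nonneg_left (hcs.trans ?_) (sq_nonneg _)
          exact mul_le_mul_of_nonneg_left hct measureReal_nonneg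
      _ = ((1 - s) ^ (-(1 / 2) : ℝ) * B) ^ 2 := by
          rw [mul_pow, hexp, hB, mul_pow, Real.sq_sqrt measureReal_nonneg, Real.sq_sqrt hJ]
          field_simp
  have hci : Continuous fun s : ℝ => ∫ y in K, (1 - s) * G (y + s • (x - y)) :=
    continuous_parametric_integral_of_continuous (f := fun s y => (1 - s) * G (y + s • (x - y)))
      (by fun_prop) hK
  have hint : IntervalIntegrable (fun s : ℝ => (1 - s) ^ (-(1 / 2) : ℝ)) volume 0 1 := by
    have := (intervalIntegral.intervalIntegrable_rpow' (a := 0) (b := 1) (r := -(1 / 2))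
      (by norm_num)).comp_sub_left 1
    simpa using this.symm
  have hval : ∫ s in (0 : ℝ)..1, (1 - s) ^ (-(1 / 2) : ℝ) = 2 := by
    rw [intervalIntegral.integral_comp_sub_left (fun s : ℝ => s ^ (-(1 / 2) : ℝ)) 1,
      integral_rpow (Or.inl (by norm_num))]
    norm_num
  calc _ ≤ ∫ s in (0 : ℝ)..1, (1 - s) ^ (-(1 / 2) : ℝ) * B := by
        refine intervalIntegral.integral_mono_on_of_le_Ioo zero_le_one
          (hci.intervalIntegrable _ _) (hint.mul_const _) hle
    _ = 2 * B := by rw [intervalIntegral.integral_mul_const, hval]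

/-- The classical `H^m` norm on `K`. -/
def classicalNorm (m : ℕ) (K : Set E3) (f : E3 → ℝ) : ℝ :=
  Real.sqrt (∑ α ∈ multiIndices m, ∫ x in K, multiDeriv α f x ^ 2)

lemma classicalNorm_nonneg (m : ℕ) (K : Set E3) (f : E3 → ℝ) : 0 ≤ classicalNorm m K f :=
  Real.sqrt_nonneg _

lemma sqrt_integral_derivSum_sq_le (m : ℕ) {K : Set E3} (hK : IsCompact K) {f : E3 → ℝ}
    (hf : ContDiff ℝ ∞ f) : Real.sqrt (∫ x in K, derivSum m f x ^ 2) ≤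
      Real.sqrt (multiIndices m).card * classicalNorm m K f := by
  rw [classicalNorm, ← Real.sqrt_mul (Nat.cast_nonneg _)]
  refine Real.sqrt_le_sqrt ?_
  have hi : ∀ α, Integrable (fun x => multiDeriv α f x ^ 2) (volume.restrict K) := fun α =>
    ((contDiff_multiDeriv α hf).continuous.pow 2).continuousOn.integrableOn_compact hK
  rw [← integral_finsetSum _ fun α _ => hi α, ← integral_const_mul]
  refine integral_mono ?_ ((integrable_finsetSum _ fun α _ => hi α).const_mul _) ?_
  · exact ((continuous_derivSum m hf).pow 2).continuousOn.integrableOn_compact hK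
  · intro x
    have := sq_sum_le_card_mul_sum_sq (s := multiIndices m) (f := fun α => |multiDeriv α f x|)
    simpa [derivSum] using this

/-- The constant in the estimate for the averaged Taylor remainder. -/
def taylorConst (m : ℕ) (D : ℝ) : ℝ :=
  (m + 2) * ((3 ^ m * D ^ m) * Real.sqrt (multiIndices m).card)

lemma taylorConst_nonneg (m : ℕ) {D : ℝ} (hD : 1 ≤ D) : 0 ≤ taylorConst m D := by
  unfold taylorConst; positivity

lemma taylorSum_diff {j m : ℕ} (h : j ≤ m) (f : E3 → ℝ) (y v : E3) :
    taylorSum m f y v - taylorSum j f y v =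
      ∑ i ∈ Finset.Ico j m, dirPow i f y v / (i.factorial : ℝ) := by
  rw [taylorSum, taylorSum, Finset.sum_Ico_eq_sub _ h]

/-- Surplus powers of the diameter are traded for powers of the bound D, so that Taylor terms of
every order from j to m scale like h^j. -/
lemma pow_mul_le {h D : ℝ} (h0 : 0 ≤ h) (hD : 1 ≤ D) (hhD : h ≤ D) {i j m : ℕ} (hj : j ≤ i)
    (hi : i ≤ m) : (3 * h) ^ i ≤ 3 ^ m * D ^ m * h ^ j := by
  obtain ⟨l, rfl⟩ := Nat.exists_eq_add_of_le hj
  have h1 : (3 : ℝ) ^ (j + l) ≤ 3 ^ m := pow_le_pow_right₀ (by norm_num) hi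
  have h2 : h ^ l ≤ D ^ m := (pow_le_pow_left₀ h0 hhD l).trans (pow_le_pow_right₀ hD (by omega))
  calc (3 * h) ^ (j + l) = 3 ^ (j + l) * h ^ l * h ^ j := by rw [mul_pow, pow_add h]; ring
    _ ≤ 3 ^ m * D ^ m * h ^ j := by gcongr

/-- The estimate for the averaged Taylor remainder. -/
theorem integral_abs_sub_taylorSum_le {K : Set E3} (hK : IsCompact K) (hKc : Convex ℝ K)
    {m j : ℕ} (hm : 2 ≤ m) (hj : j ≤ m) {D : ℝ} (hD : 1 ≤ D) (hKD : Metric.diam K ≤ D)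
    {f : E3 → ℝ} (hf : ContDiff ℝ ∞ f) {x : E3} (hx : x ∈ K) :
    ∫ y in K, |f x - taylorSum j f y (x - y)| ≤
      taylorConst m D * Metric.diam K ^ j * Real.sqrt (volume.real K) * classicalNorm m K f := by
  set h := Metric.diam K with hh
  set A := 3 ^ m * D ^ m * h ^ j with hA
  have hh0 : 0 ≤ h := Metric.diam_nonneg
  have hA0 : 0 ≤ A := by positivity
  have hds := continuous_derivSum m hf
  have hbd : ∀ y ∈ K, |f x - taylorSum j f y (x - y)| ≤
      A * (m * derivSum m f y + ∫ s in (0 : ℝ)..1, (1 - s) * derivSum m f (y + s • (x - y))) := by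
    intro y hy
    have hv : ‖x - y‖ ≤ h := by
      rw [← dist_eq_norm]; exact Metric.dist_le_diam_of_mem hK.isBounded hx hy
    -- The integral remainder is always taken at order m. The Taylor terms of order j, ..., m - 1,
    -- which are not subtracted, are bounded separately by derivatives of f at y.
    have e : f x - taylorSum j f y (x - y) = (f (y + (x - y)) - taylorSum m f y (x - y)) +
        ∑ i ∈ Finset.Ico j m, dirPow i f y (x - y) / (i.factorial : ℝ) := by
      rw [← taylorSum_diff hj, add_sub_cancel]; ring
    have hI : 0 ≤ ∫ s in (0 : ℝ)..1, (1 - s) * derivSum m f (y + s • (x - y)) :=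
      intervalIntegral.integral_nonneg zero_le_one fun s hs =>
        mul_nonneg (by linarith [hs.2]) (derivSum_nonneg _ _ _)
    have hpow : ∀ i, j ≤ i → i ≤ m → (3 * ‖x - y‖) ^ i ≤ A := fun i h1 h2 =>
      (pow_le_pow_left₀ (by positivity) (by linarith) i).trans (pow_mul_le hh0 hD hKD h1 h2)
    have hsum : |∑ i ∈ Finset.Ico j m, dirPow i f y (x - y) / (i.factorial : ℝ)| ≤
        m * (A * derivSum m f y) := by
      refine (Finset.abs_sum_le_sum_abs _ _).trans ?_
      have : ∀ i ∈ Finset.Ico j m, |dirPow i f y (x - y) / (i.factorial : ℝ)| ≤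
          A * derivSum m f y := by
        intro i hi
        rw [Finset.mem_Ico] at hi
        rw [abs_div, Nat.abs_cast]
        have hb := abs_dirPow_le (m := m) (i := i) (β := 0) (by simpa using hi.2.le) hf y (x - y)
        rw [multiDeriv_zero] at hb
        refine (div_le_self (abs_nonneg _) (by
          exact_mod_cast Nat.one_le_iff_ne_zero.2 (Nat.factorial_ne_zero _))).trans (hb.trans ?_)
        exact mul_le_mul_of_nonneg_right (hpow i hi.1 hi.2.le) (derivSum_nonneg _ _ _)
      refine (Finset.sum_le_sum this).trans ?_
      rw [Finset.sum_const, nsmul_eq_mul, Nat.card_Ico]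
      refine mul_le_mul_of_nonneg_right ?_ (mul_nonneg hA0 (derivSum_nonneg _ _ _))
      exact_mod_cast Nat.sub_le _ _
    rw [e]
    calc _ ≤ _ := abs_add_le _ _
      _ ≤ A * (∫ s in (0 : ℝ)..1, (1 - s) * derivSum m f (y + s • (x - y))) +
          m * (A * derivSum m f y) := by
          refine add_le_add ((abs_sub_taylorSum_le hm hf _ _).trans ?_) hsum
          exact mul_le_mul_of_nonneg_right (hpow m hj le_rfl) hI
      _ = _ := by ring
  have hc1 : Continuous fun y => |f x - taylorSum j f y (x - y)| :=
    (continuous_const.sub ((continuous_taylorSum j hf).comp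
      (f := fun y => (y, x - y)) (by fun_prop))).abs
  have hc2 : Continuous fun y => ∫ s in (0 : ℝ)..1, (1 - s) * derivSum m f (y + s • (x - y)) := by
    refine intervalIntegral.continuous_parametric_intervalIntegral_of_continuous'
      (f := fun y s => (1 - s) * derivSum m f (y + s • (x - y))) (by fun_prop) 0 1
  have hint : ∀ {g : E3 → ℝ}, Continuous g → Integrable g (volume.restrict K) := fun hg =>
    hg.continuousOn.integrableOn_compact hK
  have h1 : ∫ y in K, derivSum m f y ≤
      Real.sqrt (volume.real K) * Real.sqrt (∫ y in K, derivSum m f y ^ 2) := by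
    rw [← Real.sqrt_mul measureReal_nonneg]
    exact Real.le_sqrt_of_sq_le (sq_setIntegral_le hK hds)
  have h2 := integral_taylor_kernel_le hK hKc hx hds
  have h3 := sqrt_integral_derivSum_sq_le m hK hf
  calc _ ≤ ∫ y in K, A * (m * derivSum m f y +
        ∫ s in (0 : ℝ)..1, (1 - s) * derivSum m f (y + s • (x - y))) :=
        setIntegral_mono_on (hint hc1)
          (hint (continuous_const.mul ((continuous_const.mul hds).add hc2))) hK.measurableSet hbd
    _ = A * (m * (∫ y in K, derivSum m f y) +
        ∫ y in K, ∫ s in (0 : ℝ)..1, (1 - s) * derivSum m f (y + s • (x - y))) := by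
        rw [integral_const_mul, integral_add (f := fun y => (m : ℝ) * derivSum m f y)
          (hint (continuous_const.mul hds)) (hint hc2),
          integral_const_mul]
    _ ≤ A * (m * (Real.sqrt (volume.real K) * Real.sqrt (∫ y in K, derivSum m f y ^ 2)) +
        2 * (Real.sqrt (volume.real K) * Real.sqrt (∫ y in K, derivSum m f y ^ 2))) := by gcongr
    _ = A * (m + 2) * Real.sqrt (volume.real K) * Real.sqrt (∫ y in K, derivSum m f y ^ 2) := by
        ring
    _ ≤ A * (m + 2) * Real.sqrt (volume.real K) *
        (Real.sqrt (multiIndices m).card * classicalNorm m K f) := by gcongr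
    _ = _ := by rw [hA, taylorConst]; ring

/-! ### Polynomial functions -/

/-- `f` is a polynomial function of degree at most `m`. -/
def IsPoly (m : ℕ) (f : E3 → ℝ) : Prop := ∃ q ∈ polySpace m, ∀ x, f x = polyEval q x

lemma mem_polySpace {m : ℕ} {q : Poly3} : q ∈ polySpace m ↔ q.totalDegree ≤ m :=
  MvPolynomial.mem_restrictTotalDegree _ _ _

lemma polySpace_mono {m n : ℕ} (h : m ≤ n) : polySpace m ≤ polySpace n := fun _ hq =>
  mem_polySpace.2 ((mem_polySpace.1 hq).trans h)

lemma analyticOnNhd_polyEval (q : Poly3) : AnalyticOnNhd ℝ (polyEval q) univ :=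
  fun x _ => AnalyticAt.aeval_mvPolynomial (f := fun y : E3 => fun i => y i)
    (fun i => (EuclideanSpace.proj i : E3 →L[ℝ] ℝ).analyticAt x) q

lemma contDiff_polyEval (q : Poly3) : ContDiff ℝ ∞ (polyEval q) :=
  (analyticOnNhd_polyEval q).contDiff

lemma continuous_polyEval (q : Poly3) : Continuous (polyEval q) :=
  (contDiff_polyEval q).continuous

lemma partialDeriv_polyEval (k : Fin 3) (q : Poly3) :
    partialDeriv k (polyEval q) = polyEval (MvPolynomial.pderiv k q) := by
  induction q using MvPolynomial.induction_on with
  | C a =>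
    have : polyEval (MvPolynomial.C a) = fun _ => a := by funext x; simp [polyEval]
    rw [this, MvPolynomial.pderiv_C]
    funext x
    simp [partialDeriv, polyEval]
  | add p q hp hq =>
    have : polyEval (p + q) = polyEval p + polyEval q := by funext x; simp [polyEval]
    rw [this, partialDeriv_add (contDiff_polyEval p) (contDiff_polyEval q), hp, hq, map_add]
    funext x; simp [polyEval]
  | mul_X p i hp =>
    have h1 : polyEval (p * MvPolynomial.X i) = fun x => polyEval p x * x i := by
      funext x; simp [polyEval]
    funext x
    have hx : HasFDerivAt (fun x : E3 => x i) (EuclideanSpace.proj i : E3 →L[ℝ] ℝ) x :=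
      (EuclideanSpace.proj i : E3 →L[ℝ] ℝ).hasFDerivAt
    have hp' := congrFun hp x
    simp only [partialDeriv] at hp'
    have h2 := (((contDiff_polyEval p).differentiable (by simp) x).hasFDerivAt.mul hx).fderiv
    rw [h1, partialDeriv]
    change (fderiv ℝ (polyEval p * fun x => x i) x) _ = _
    rw [h2, MvPolynomial.pderiv_mul]
    simp only [add_apply, smul_apply, smul_eq_mul, hp']
    simp [polyEval, MvPolynomial.pderiv_X, Pi.single_apply]
    split_ifs <;> simp [mul_comm, add_comm]

lemma pderiv_mem_polySpace (k : Fin 3) {m : ℕ} {q : Poly3} (hq : q ∈ polySpace m) :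
    MvPolynomial.pderiv k q ∈ polySpace m := by
  rw [q.as_sum, map_sum]
  refine Submodule.sum_mem _ fun s hs => ?_
  rw [MvPolynomial.pderiv_monomial, mem_polySpace]
  refine (MvPolynomial.totalDegree_monomial_le _ _).trans
    (le_trans ?_ ((MvPolynomial.le_totalDegree hs).trans (mem_polySpace.1 hq)))
  rw [Finsupp.sum_fintype _ _ (by simp), Finsupp.sum_fintype _ _ (by simp)]
  exact Finset.sum_le_sum fun i _ => by simp

namespace IsPoly

variable {m n : ℕ} {f g : E3 → ℝ}

lemma contDiff (hf : IsPoly m f) : ContDiff ℝ ∞ f := by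
  obtain ⟨q, _, h⟩ := hf
  rw [show f = polyEval q from funext h]
  exact contDiff_polyEval q

lemma mono (hf : IsPoly m f) (h : m ≤ n) : IsPoly n f := by
  obtain ⟨q, hq, h'⟩ := hf
  exact ⟨q, polySpace_mono h hq, h'⟩

lemma const (c : ℝ) : IsPoly m fun _ => c :=
  ⟨MvPolynomial.C c, mem_polySpace.2 (by simp), fun x => by simp [polyEval]⟩

lemma coord (k : Fin 3) : IsPoly 1 fun x => x k :=
  ⟨MvPolynomial.X k, mem_polySpace.2 (by simp), fun x => by simp [polyEval]⟩

lemma add (hf : IsPoly m f) (hg : IsPoly m g) : IsPoly m fun x => f x + g x := by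
  obtain ⟨q, hq, hf⟩ := hf
  obtain ⟨r, hr, hg⟩ := hg
  exact ⟨q + r, Submodule.add_mem _ hq hr, fun x => by simp [polyEval, hf, hg]⟩

lemma mul (hf : IsPoly m f) (hg : IsPoly n g) : IsPoly (m + n) fun x => f x * g x := by
  obtain ⟨q, hq, hf⟩ := hf
  obtain ⟨r, hr, hg⟩ := hg
  refine ⟨q * r, mem_polySpace.2 ?_, fun x => by simp [polyEval, hf, hg]⟩
  exact (MvPolynomial.totalDegree_mul _ _).trans
    (add_le_add (mem_polySpace.1 hq) (mem_polySpace.1 hr))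

lemma const_mul (hf : IsPoly m f) (c : ℝ) : IsPoly m fun x => c * f x := by
  simpa using (const (m := 0) c).mul hf

lemma sub (hf : IsPoly m f) (hg : IsPoly m g) : IsPoly m fun x => f x - g x := by
  simpa [sub_eq_add_neg] using hf.add (hg.const_mul (-1))

lemma sum {ι : Type*} (s : Finset ι) {F : ι → E3 → ℝ} (h : ∀ i ∈ s, IsPoly m (F i)) :
    IsPoly m fun x => ∑ i ∈ s, F i x := by
  classical
  induction s using Finset.induction_on with
  | empty => simpa using const 0
  | insert a s ha ih =>
    simp_rw [Finset.sum_insert ha]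
    exact (h a (Finset.mem_insert_self _ _)).add
      (ih fun i hi => h i (Finset.mem_insert_of_mem hi))

lemma pow (hf : IsPoly m f) (n : ℕ) : IsPoly (n * m) fun x => f x ^ n := by
  induction n with
  | zero => simpa using const 1
  | succ n ih => simpa [pow_succ, Nat.succ_mul] using ih.mul hf

lemma partialDeriv (hf : IsPoly m f) (k : Fin 3) : IsPoly m (MassLumping.partialDeriv k f) := by
  obtain ⟨q, hq, h⟩ := hf
  rw [show f = polyEval q from funext h, partialDeriv_polyEval]
  exact ⟨_, pderiv_mem_polySpace k hq, fun _ => rfl⟩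

/-- Affine substitutions do not raise the degree, so polynomials may be moved between an element and
the reference element. -/
lemma comp (hf : IsPoly m f) {φ : E3 → E3} (hφ : ∀ k, IsPoly 1 fun x => φ x k) :
    IsPoly m fun x => f (φ x) := by
  obtain ⟨q, hq, h⟩ := hf
  simp_rw [h, polyEval, MvPolynomial.eval_eq']
  refine sum _ fun s hs => IsPoly.const_mul ?_ _
  have hd := (MvPolynomial.le_totalDegree hs).trans (mem_polySpace.1 hq)
  rw [Finsupp.sum_fintype _ _ (by simp), Fin.sum_univ_three] at hd
  simp_rw [Fin.prod_univ_three]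
  refine IsPoly.mono (((hφ 0).pow (s 0)).mul ((hφ 1).pow (s 1)) |>.mul ((hφ 2).pow (s 2))) ?_
  simpa using hd

end IsPoly

lemma isPoly_affine (ℓ : E3 →ᵃ[ℝ] ℝ) : IsPoly 1 ℓ := by
  have : ∀ x, ℓ x = (∑ k, ℓ.linear (EuclideanSpace.single k 1) * x k) + ℓ 0 := by
    intro x
    have h := congrFun ℓ.decomp x
    simp only [Pi.add_apply] at h
    rw [h]
    conv_lhs => rw [E3.eq_sum_single x]
    simp [mul_comm]
  rw [show (ℓ : E3 → ℝ) = fun x => (∑ k, ℓ.linear (EuclideanSpace.single k 1) * x k) + ℓ 0 from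
    funext this]
  exact (IsPoly.sum _ fun k _ => (IsPoly.coord k).const_mul _).add (IsPoly.const _)

lemma isPoly_dirPow (i : ℕ) (f : E3 → ℝ) (y : E3) : IsPoly i fun v => dirPow i f y v := by
  induction i generalizing f with
  | zero => exact IsPoly.const _
  | succ i ih =>
    refine IsPoly.sum _ fun k _ => ?_
    rw [add_comm i 1]
    exact (IsPoly.coord k).mul (ih _)

/-- The hypothesis j ≤ n + 1 rather than n = j - 1 includes j = 0, where the sum is empty and n = 0
is allowed. -/
lemma isPoly_taylorSum {j n : ℕ} (h : j ≤ n + 1) (f : E3 → ℝ) (y : E3) :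
    IsPoly n fun x => taylorSum j f y (x - y) := by
  refine IsPoly.sum _ fun i hi => ?_
  rw [Finset.mem_range] at hi
  have h1 : IsPoly n fun x => dirPow i f y (x - y) :=
    ((isPoly_dirPow i f y).mono (by omega)).comp fun k =>
      (IsPoly.coord k).sub (IsPoly.const (y k))
  simpa [div_eq_inv_mul] using h1.const_mul (i.factorial : ℝ)⁻¹

/-! ### The geometry of tetrahedra -/

namespace Tetrahedron

lemma isCompact_closedCell (e : Tetrahedron) : IsCompact (closedCell e) :=
  (finite_range e).isCompact_convexHull (𝕜 := ℝ)

lemma convex_closedCell (e : Tetrahedron) : Convex ℝ (closedCell e) := convex_convexHull ℝ _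

lemma isOpen_openCell (e : Tetrahedron) : IsOpen (openCell e) := isOpen_interior

lemma openCell_subset (e : Tetrahedron) : openCell e ⊆ closedCell e := interior_subset

lemma openCell_nonempty (e : Tetrahedron) : (openCell e).Nonempty :=
  ⟨_, e.centroid_mem_interior_convexHull⟩

lemma closure_openCell (e : Tetrahedron) : closure (openCell e) = closedCell e := by
  rw [openCell, (convex_closedCell e).closure_interior_eq_closure_of_nonempty_interior
    (openCell_nonempty e), (isCompact_closedCell e).isClosed.closure_eq]

lemma vol_pos (e : Tetrahedron) : 0 < vol e := by
  have h := (isOpen_openCell e).measure_pos volume (openCell_nonempty e)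
  exact ENNReal.toReal_pos (h.trans_le (measure_mono (openCell_subset e))).ne'
    (isCompact_closedCell e).measure_lt_top.ne

lemma openCell_ae_eq (e : Tetrahedron) : openCell e =ᵐ[volume] closedCell e :=
  interior_ae_eq_of_null_frontier ((convex_closedCell e).addHaar_frontier volume)

lemma restrict_openCell (e : Tetrahedron) :
    volume.restrict (openCell e) = volume.restrict (closedCell e) :=
  Measure.restrict_congr_set (openCell_ae_eq e)

lemma integrableOn (e : Tetrahedron) {f : E3 → ℝ} (hf : ContinuousOn f (closedCell e)) :
    Integrable f (volume.restrict (closedCell e)) :=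
  hf.integrableOn_compact (isCompact_closedCell e)

/-- Functions continuous on the closed cell that agree almost everywhere agree everywhere. -/
lemma eqOn_of_ae_eq (e : Tetrahedron) {f g : E3 → ℝ} (hf : ContinuousOn f (closedCell e))
    (hg : ContinuousOn g (closedCell e)) (h : f =ᵐ[volume.restrict (openCell e)] g) :
    EqOn f g (closedCell e) := by
  have h1 : EqOn f g (openCell e) :=
    Measure.eqOn_open_of_ae_eq h (isOpen_openCell e) (hf.mono (openCell_subset e))
      (hg.mono (openCell_subset e))
  exact h1.of_subset_closure hf hg (openCell_subset e) (closure_openCell e).ge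

end Tetrahedron

open Tetrahedron

/-- Barycentric coordinates are preserved; invertibility of the map and the images of the open and
closed cells all follow from this. -/
lemma coord_refMap (ref e : Tetrahedron) (x : E3) (i : Fin 4) :
    e.coord i (refMap ref e x) = ref.coord i x := by
  have hs : ∑ i, ref.coord i x = 1 := ref.sum_coord_apply_eq_one x
  rw [refMap, ← Finset.affineCombination_eq_linear_combination _ _ _ hs]
  exact e.coord_apply_combination_of_mem (Finset.mem_univ i) hs

lemma refMap_refMap (ref e : Tetrahedron) (x : E3) : refMap e ref (refMap ref e x) = x := by
  rw [refMap]
  simp_rw [coord_refMap]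
  exact ref.linear_combination_coord_eq_self x

lemma refMap_mem_closedCell {ref e : Tetrahedron} {x : E3} :
    refMap ref e x ∈ closedCell e ↔ x ∈ closedCell ref := by
  rw [closedCell, closedCell, e.convexHull_eq_nonneg_coord, ref.convexHull_eq_nonneg_coord]
  simp [coord_refMap]

lemma refMap_mem_openCell {ref e : Tetrahedron} {x : E3} :
    refMap ref e x ∈ openCell e ↔ x ∈ openCell ref := by
  rw [openCell, openCell, closedCell, closedCell, e.interior_convexHull, ref.interior_convexHull]
  simp [coord_refMap]

lemma refMap_image (ref e : Tetrahedron) : refMap ref e '' closedCell ref = closedCell e := by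
  ext y
  constructor
  · rintro ⟨x, hx, rfl⟩; exact refMap_mem_closedCell.2 hx
  · intro hy
    exact ⟨refMap e ref y, refMap_mem_closedCell.2 hy, refMap_refMap e ref y⟩

lemma isPoly_refMap (ref e : Tetrahedron) (k : Fin 3) : IsPoly 1 fun x => refMap ref e x k := by
  simp only [refMap, WithLp.ofLp_sum, WithLp.ofLp_smul, Finset.sum_apply, Pi.smul_apply,
    smul_eq_mul]
  refine IsPoly.sum _ fun i _ => ?_
  simpa [mul_comm] using (isPoly_affine (ref.coord i)).const_mul (e i k)

lemma hasFDerivAt_refMap (ref e : Tetrahedron) : ∃ A : E3 →L[ℝ] E3, ∀ x,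
    HasFDerivAt (refMap ref e) A x := by
  refine ⟨∑ i, (LinearMap.toContinuousLinearMap (ref.coord i).linear).smulRight (e i), fun x => ?_⟩
  refine HasFDerivAt.fun_sum fun i _ => ?_
  refine HasFDerivAt.smul_const ?_ _
  have h : (ref.coord i : E3 → ℝ) = fun x =>
      LinearMap.toContinuousLinearMap (ref.coord i).linear x + ref.coord i 0 := by
    conv_lhs => rw [(ref.coord i).decomp]
    rfl
  rw [h]
  exact (ContinuousLinearMap.hasFDerivAt _).add_const _

/-- The Jacobian is constant, so integrating the function 1 identifies it as the ratio of volumes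
without computing a determinant. -/
lemma setIntegral_refMap (ref e : Tetrahedron) (g : E3 → ℝ) :
    ∫ y in closedCell e, g y = vol e / vol ref * ∫ x in closedCell ref, g (refMap ref e x) := by
  obtain ⟨A, hA⟩ := hasFDerivAt_refMap ref e
  have key : ∀ g : E3 → ℝ, ∫ y in closedCell e, g y =
      |A.det| * ∫ x in closedCell ref, g (refMap ref e x) := by
    intro g
    rw [← refMap_image ref e, integral_image_eq_integral_abs_det_fderiv_smul volume
      (isCompact_closedCell ref).measurableSet (fun x _ => (hA x).hasFDerivWithinAt)
      (fun x _ y _ h => by rw [← refMap_refMap ref e x, h, refMap_refMap]) g]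
    simp only [smul_eq_mul]
    rw [integral_const_mul]
  have h1 := key fun _ => 1
  simp only [integral_const, measureReal_restrict_apply_univ, smul_eq_mul, mul_one] at h1
  have hv : volume.real (closedCell ref) ≠ 0 := (vol_pos ref).ne'
  rw [key g, vol, vol, h1, mul_div_cancel_right₀ _ hv]

/-- Differentiable maps between spaces of equal dimension send null sets to null sets. -/
lemma ae_openCell_of_refMap (ref e : Tetrahedron) {P : E3 → Prop}
    (h : ∀ᵐ x ∂(volume.restrict (openCell ref)), P (refMap ref e x)) :
    ∀ᵐ y ∂(volume.restrict (openCell e)), P y := by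
  obtain ⟨A, hA⟩ := hasFDerivAt_refMap ref e
  rw [ae_restrict_iff' (isOpen_openCell _).measurableSet] at h ⊢
  have h2 : volume (refMap ref e '' {x | ¬ (x ∈ openCell ref → P (refMap ref e x))}) = 0 :=
    addHaar_image_eq_zero_of_differentiableOn_of_addHaar_eq_zero volume
      (fun x _ => (hA x).differentiableAt.differentiableWithinAt) h
  refine measure_mono_null ?_ h2
  intro y hy
  refine ⟨refMap e ref y, ?_, refMap_refMap e ref y⟩
  simp only [mem_compl_iff, mem_ofPred_eq, Classical.not_imp] at hy ⊢
  rw [refMap_refMap, refMap_mem_openCell]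
  exact hy

/-! ### An inverse inequality -/

/-- The polynomial vanishes on the open cell by continuity, hence everywhere by analyticity. -/
lemma eq_zero_of_integral_sq_eq_zero (e : Tetrahedron) {q : Poly3}
    (h : ∫ x in closedCell e, polyEval q x ^ 2 = 0) : q = 0 := by
  have hc := continuous_polyEval q
  have h1 : (fun x => polyEval q x ^ 2) =ᵐ[volume.restrict (closedCell e)] 0 :=
    (integral_eq_zero_iff_of_nonneg (fun x => sq_nonneg _)
      (integrableOn e (hc.pow 2).continuousOn)).1 h
  rw [← restrict_openCell] at h1
  have h2 := eqOn_of_ae_eq e (hc.pow 2).continuousOn continuousOn_const h1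
  obtain ⟨z, hz⟩ := openCell_nonempty e
  have h3 : polyEval q = polyEval 0 := by
    refine (analyticOnNhd_polyEval q).eq_of_eventuallyEq (analyticOnNhd_polyEval 0) (z₀ := z) ?_
    filter_upwards [(isOpen_openCell e).mem_nhds hz] with x hx
    have := h2 (openCell_subset e hx)
    have h0 : polyEval q x = 0 := pow_eq_zero_iff two_ne_zero |>.1 this
    rw [h0]; simp [polyEval]
  refine MvPolynomial.funext fun x => ?_
  simpa [polyEval] using congrFun h3 (WithLp.toLp 2 x)

/-- Equivalence of norms in finite dimension: in coordinates for a basis, the quotient of the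
squared value by the squared L² norm is continuous on the compact product of the unit sphere and the
cell. Homogeneity removes the normalization. -/
lemma exists_inverse_inequality_ref (ref : Tetrahedron) (M : ℕ) : ∃ C : ℝ, 0 ≤ C ∧
    ∀ f, IsPoly M f → ∀ x ∈ closedCell ref, f x ^ 2 ≤ C * ∫ y in closedCell ref, f y ^ 2 := by
  have : Module.Finite ℝ (polySpace M) :=
    inferInstanceAs (Module.Finite ℝ (MvPolynomial.restrictTotalDegree (Fin 3) ℝ M))
  let b := Module.finBasis ℝ (polySpace M)
  set n := Module.finrank ℝ (polySpace M)
  let S : EuclideanSpace ℝ (Fin n) → E3 → ℝ := fun c x => ∑ i, c i * polyEval (b i : Poly3) x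
  have hS : Continuous fun z : EuclideanSpace ℝ (Fin n) × E3 => S z.1 z.2 := by
    refine continuous_finsetSum _ fun i _ => Continuous.mul (by fun_prop)
      ((continuous_polyEval _).comp continuous_snd)
  have hSe : ∀ c, S c = polyEval (∑ i, c i • (b i : Poly3)) := by
    intro c; funext x; simp [S, polyEval, MvPolynomial.smul_eval]
  let J : EuclideanSpace ℝ (Fin n) → ℝ := fun c => ∫ x in closedCell ref, S c x ^ 2
  have hJ : Continuous J := continuous_parametric_integral_of_continuous
    (f := fun c x => S c x ^ 2) (by exact hS.pow 2) (isCompact_closedCell ref)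
  have hJpos : ∀ c, c ≠ 0 → 0 < J c := by
    intro c hc
    refine lt_of_le_of_ne (integral_nonneg fun x => sq_nonneg _) fun h => hc ?_
    simp only [J, hSe] at h
    have h0 := eq_zero_of_integral_sq_eq_zero ref h.symm
    have h1 : ∑ i, c i • b i = 0 := by
      apply Subtype.ext
      simpa using h0
    have h2 := Fintype.linearIndependent_iff.1 b.linearIndependent _ h1
    ext i; exact h2 i
  have hhom : ∀ (t : ℝ) c x, S (t • c) x = t * S c x := by
    intro t c x; simp [S, Finset.mul_sum, mul_assoc]
  obtain ⟨B, hB⟩ : ∃ B : ℝ, ∀ c ∈ Metric.sphere (0 : EuclideanSpace ℝ (Fin n)) 1,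
      ∀ x ∈ closedCell ref, S c x ^ 2 ≤ B * J c := by
    have hcomp := (isCompact_sphere (0 : EuclideanSpace ℝ (Fin n)) 1).prod (isCompact_closedCell ref)
    have hcont : ContinuousOn (fun z : EuclideanSpace ℝ (Fin n) × E3 => S z.1 z.2 ^ 2 / J z.1)
        (Metric.sphere 0 1 ×ˢ closedCell ref) := by
      refine (hS.pow 2).continuousOn.div (hJ.comp continuous_fst).continuousOn fun z hz => ?_
      exact (hJpos _ (ne_zero_of_mem_sphere (by norm_num) ⟨z.1, hz.1⟩)).ne'
    obtain ⟨B, hB⟩ := (hcomp.image_of_continuousOn hcont).bddAbove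
    refine ⟨B, fun c hc x hx => ?_⟩
    have := hB (mem_image_of_mem _ (show (c, x) ∈ _ from ⟨hc, hx⟩))
    rwa [div_le_iff₀ (hJpos _ (ne_zero_of_mem_sphere (by norm_num) ⟨c, hc⟩))] at this
  refine ⟨max B 0, le_max_right _ _, ?_⟩
  rintro f ⟨q, hq, hf⟩ x hx
  let c : EuclideanSpace ℝ (Fin n) := WithLp.toLp 2 (b.repr ⟨q, hq⟩)
  have hfc : f = S c := by
    rw [hSe, funext hf]
    have := congrArg Subtype.val (b.sum_repr ⟨q, hq⟩)
    simp only [AddSubmonoidClass.coe_finsetSum, SetLike.val_smul] at this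
    rw [← this]
  rw [hfc]
  change S c x ^ 2 ≤ max B 0 * J c
  by_cases hc : c = 0
  · have : S c x = 0 := by simp [S, hc]
    rw [this, zero_pow two_ne_zero]
    exact mul_nonneg (le_max_right _ _) (integral_nonneg fun x => sq_nonneg _)
  · have hn : 0 < ‖c‖ := norm_pos_iff.2 hc
    set d := ‖c‖⁻¹ • c with hd
    have hcd : c = ‖c‖ • d := by rw [hd, smul_smul, mul_inv_cancel₀ hn.ne', one_smul]
    have hds : d ∈ Metric.sphere (0 : EuclideanSpace ℝ (Fin n)) 1 := by
      simp [hd, norm_smul, hn.ne']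
    have h1 := hB d hds x hx
    have h2 : J c = ‖c‖ ^ 2 * J d := by
      simp only [J]
      rw [← integral_const_mul, hcd]
      congr 1; funext y
      rw [hhom, ← hcd]; ring
    have h3 : S c x = ‖c‖ * S d x := by rw [← hhom, ← hcd]
    have hJd : 0 ≤ J d := integral_nonneg fun x => sq_nonneg _
    rw [h2, h3, mul_pow]
    calc ‖c‖ ^ 2 * S d x ^ 2 ≤ ‖c‖ ^ 2 * (max B 0 * J d) := by
          gcongr; exact h1.trans (by gcongr; exact le_max_left _ _)
      _ = _ := by ring

/-- The inverse inequality on an arbitrary tetrahedron. -/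
lemma exists_inverse_inequality (ref : Tetrahedron) (M : ℕ) : ∃ C : ℝ, 0 ≤ C ∧
    ∀ (e : Tetrahedron) (f : E3 → ℝ), IsPoly M f → ∀ x ∈ closedCell e,
      Real.sqrt (vol e) * |f x| ≤ C * Real.sqrt (∫ y in closedCell e, f y ^ 2) := by
  obtain ⟨C, hC, h⟩ := exists_inverse_inequality_ref ref M
  refine ⟨Real.sqrt (C * vol ref), Real.sqrt_nonneg _, fun e f hf x hx => ?_⟩
  have h1 := h _ (hf.comp (isPoly_refMap ref e)) (refMap e ref x) (refMap_mem_closedCell.2 hx)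
  simp only [refMap_refMap] at h1
  have hve := vol_pos e
  have hvr := vol_pos ref
  rw [← Real.sqrt_mul (by positivity), ← Real.sqrt_sq_eq_abs, ← Real.sqrt_mul hve.le]
  refine Real.sqrt_le_sqrt ?_
  -- The substitution multiplies the integral by |e| / |ref|: the |e| is matched by the factor on
  -- the left, the |ref| by the one inside the constant.
  rw [setIntegral_refMap ref e]
  calc vol e * f x ^ 2 ≤ vol e * (C * ∫ y in closedCell ref, f (refMap ref e y) ^ 2) := by gcongr
    _ = _ := by field_simp

/-! ### The integration error on one element -/

/-- The integration error on the element `e` for functions continuous on the closed element. -/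
def cellError (ref : Tetrahedron) (Q : Finset E3) (wt : E3 → ℝ) (e : Tetrahedron)
    (u w : E3 → ℝ) : ℝ :=
  (∫ x in closedCell e, u x * w x) -
    vol e / vol ref * ∑ x ∈ Q, wt x * (u (refMap ref e x) * w (refMap ref e x))

section

variable {ref : Tetrahedron} {Q : Finset E3} {wt : E3 → ℝ} {e : Tetrahedron}

lemma cellError_sub_left {u v w : E3 → ℝ} (hu : ContinuousOn u (closedCell e))
    (hv : ContinuousOn v (closedCell e)) (hw : ContinuousOn w (closedCell e)) :
    cellError ref Q wt e (fun x => u x - v x) w =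
      cellError ref Q wt e u w - cellError ref Q wt e v w := by
  simp only [cellError, sub_mul, mul_sub, Finset.sum_sub_distrib]
  rw [integral_sub (f := fun x => u x * w x) (g := fun x => v x * w x)
    (integrableOn e (hu.mul hw)) (integrableOn e (hv.mul hw))]
  ring

lemma cellError_add_right {u v w : E3 → ℝ} (hu : ContinuousOn u (closedCell e))
    (hv : ContinuousOn v (closedCell e)) (hw : ContinuousOn w (closedCell e)) :
    cellError ref Q wt e u (fun x => v x + w x) =
      cellError ref Q wt e u v + cellError ref Q wt e u w := by
  simp only [cellError, mul_add, Finset.sum_add_distrib]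
  rw [integral_add (f := fun x => u x * v x) (g := fun x => u x * w x)
    (integrableOn e (hu.mul hv)) (integrableOn e (hu.mul hw))]
  ring

lemma cellError_eq_zero_of_exact {V U : Submodule ℝ Poly3}
    (hexact : IsExactOnProducts ref Q wt V U) {f g : E3 → ℝ} {F G : Poly3} (hF : F ∈ V)
    (hG : G ∈ U) (hf : ∀ x, f (refMap ref e x) = polyEval F x)
    (hg : ∀ x, g (refMap ref e x) = polyEval G x) : cellError ref Q wt e f g = 0 := by
  rw [cellError, setIntegral_refMap ref e]
  simp_rw [hf, hg]
  rw [hexact F hF G hG, sub_self]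

/-- Exactness is applied to the pair (1, f g) instead of (f, g): the product has degree at most p
and therefore lies in `U`. This lets f have degree above p - 2. -/
lemma cellError_eq_zero_of_degree {p : ℕ} {U : Submodule ℝ Poly3} (hU : polySpace p ≤ U)
    (hexact : IsExactOnProducts ref Q wt (polySpace (p - 2)) U) {f g : E3 → ℝ} {a b : ℕ}
    (hab : a + b ≤ p) (hf : IsPoly a f) (hg : IsPoly b g) : cellError ref Q wt e f g = 0 := by
  obtain ⟨G, hG, hfg⟩ := ((hf.mul hg).mono hab).comp (isPoly_refMap ref e)
  have h := cellError_eq_zero_of_exact (e := e) hexact (f := fun _ => 1)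
    (g := fun x => f x * g x) (F := 1)
    (mem_polySpace.2 (by simp)) (hU hG) (fun x => by simp [polyEval]) hfg
  simpa [cellError] using h

/-- The bound is additive in |g|, with one integral and one sum with positive weights, so that it
can be averaged over a parameter on which g depends. -/
lemma abs_cellError_le_sum (hQ : ∀ x ∈ Q, x ∈ closedCell ref) (hwt : ∀ x ∈ Q, 0 < wt x)
    {g W : E3 → ℝ} (hg : ContinuousOn g (closedCell e)) (hW : ContinuousOn W (closedCell e))
    {B : ℝ} (hB : ∀ x ∈ closedCell e, |W x| ≤ B) :
    |cellError ref Q wt e g W| ≤ B * ((∫ x in closedCell e, |g x|) +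
      vol e / vol ref * ∑ x ∈ Q, wt x * |g (refMap ref e x)|) := by
  have hm := (isCompact_closedCell e).measurableSet
  have h1 : |∫ x in closedCell e, g x * W x| ≤ B * ∫ x in closedCell e, |g x| := by
    rw [← integral_const_mul]
    refine abs_integral_le_integral_abs.trans (setIntegral_mono_on (integrableOn e (hg.mul hW).abs)
      ((integrableOn e hg.abs).const_mul _) hm fun x hx => ?_)
    rw [abs_mul, mul_comm]
    exact mul_le_mul_of_nonneg_right (hB x hx) (abs_nonneg _)
  have h2 : |∑ x ∈ Q, wt x * (g (refMap ref e x) * W (refMap ref e x))| ≤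
      B * ∑ x ∈ Q, wt x * |g (refMap ref e x)| := by
    rw [Finset.mul_sum]
    refine (Finset.abs_sum_le_sum_abs _ _).trans (Finset.sum_le_sum fun x hx => ?_)
    rw [abs_mul, abs_mul, abs_of_pos (hwt x hx)]
    calc _ ≤ wt x * (|g (refMap ref e x)| * B) := by
          have := hB _ (refMap_mem_closedCell.2 (hQ x hx))
          have := (hwt x hx).le
          gcongr
      _ = _ := by ring
  have h3 : 0 ≤ vol e / vol ref := (div_pos (vol_pos e) (vol_pos ref)).le
  calc _ ≤ |∫ x in closedCell e, g x * W x| +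
        |vol e / vol ref * ∑ x ∈ Q, wt x * (g (refMap ref e x) * W (refMap ref e x))| :=
        abs_sub _ _
    _ ≤ B * (∫ x in closedCell e, |g x|) +
        vol e / vol ref * (B * ∑ x ∈ Q, wt x * |g (refMap ref e x)|) := by
        rw [abs_mul, abs_of_nonneg h3]; gcongr
    _ = _ := by ring

/-- If the integration error vanishes on polynomials of low degree, it is small for smooth
functions. -/
theorem abs_cellError_le_of_contDiff (hQ : ∀ x ∈ Q, x ∈ closedCell ref)
    (hwt : ∀ x ∈ Q, 0 < wt x) {m j n : ℕ} (hm : 2 ≤ m) (hj : j ≤ m) (hjn : j ≤ n + 1) {D : ℝ}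
    (hD : 1 ≤ D) (hKD : Metric.diam (closedCell e) ≤ D) {f W : E3 → ℝ} (hf : ContDiff ℝ ∞ f)
    (hW : ContinuousOn W (closedCell e)) {B : ℝ} (hB : ∀ x ∈ closedCell e, |W x| ≤ B)
    (hvan : ∀ q, IsPoly n q → cellError ref Q wt e q W = 0) :
    |cellError ref Q wt e f W| ≤ (1 + (∑ x ∈ Q, wt x) / vol ref) * taylorConst m D *
      Metric.diam (closedCell e) ^ j *
        (Real.sqrt (vol e) * B * classicalNorm m (closedCell e) f) := by
  set K := closedCell e
  have hKcpt : IsCompact K := isCompact_closedCell e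
  set E := |cellError ref Q wt e f W| with hE
  set R : E3 → E3 → ℝ := fun y x => |f x - taylorSum j f y (x - y)| with hR
  have hRc : Continuous fun z : E3 × E3 => R z.1 z.2 :=
    ((hf.continuous.comp continuous_snd).sub ((continuous_taylorSum j hf).comp
      (f := fun z : E3 × E3 => (z.1, z.2 - z.1)) (by fun_prop))).abs
  set T := taylorConst m D * Metric.diam K ^ j * Real.sqrt (volume.real K) * classicalNorm m K f
    with hT
  have hTay : ∀ x ∈ K, ∫ y in K, R y x ≤ T := fun x hx =>
    integral_abs_sub_taylorSum_le hKcpt (convex_closedCell e) hm hj hD hKD hf hx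
  have hve := vol_pos e
  have hvr := vol_pos ref
  have hB0 : 0 ≤ B := by
    obtain ⟨x, hx⟩ := openCell_nonempty e
    exact (abs_nonneg _).trans (hB x (openCell_subset e hx))
  -- For every base point y a Taylor polynomial may be subtracted at no cost. The left side does not
  -- depend on y, so the inequality can be integrated over y in K.
  have hpt : ∀ y, E ≤ B * ((∫ x in K, R y x) +
      vol e / vol ref * ∑ x ∈ Q, wt x * R y (refMap ref e x)) := by
    intro y
    have hp := isPoly_taylorSum hjn f y
    have hcp := hp.contDiff.continuous.continuousOn (s := K)
    have h1 := cellError_sub_left (ref := ref) (Q := Q) (wt := wt) hf.continuous.continuousOn hcp hW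
    rw [hvan _ hp, sub_zero] at h1
    rw [hE, ← h1]
    exact abs_cellError_le_sum hQ hwt (hf.continuous.continuousOn.sub hcp) hW hB
  have hint : ∀ {g : E3 → ℝ}, Continuous g → Integrable g (volume.restrict K) := fun hg =>
    integrableOn e hg.continuousOn
  have hRx : ∀ x, Continuous fun y => R y x := fun x =>
    hRc.comp (f := fun y => (y, x)) (by fun_prop)
  have hRI : Continuous fun y => ∫ x in K, R y x :=
    continuous_parametric_integral_of_continuous hRc hKcpt
  have hRI' : Continuous fun x => ∫ y in K, R y x :=
    continuous_parametric_integral_of_continuous (f := fun x y => R y x)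
      (by exact hRc.comp continuous_swap) hKcpt
  have hRS : Continuous fun y => ∑ x ∈ Q, wt x * R y (refMap ref e x) :=
    continuous_finsetSum _ fun x _ => continuous_const.mul (hRx _)
  -- With y integrated first, each x sees the averaged remainder; this also handles the point values
  -- at the nodes.
  have hswap : ∫ y in K, ∫ x in K, R y x = ∫ x in K, ∫ y in K, R y x := by
    refine integral_integral_swap (f := R) ?_
    rw [Measure.prod_restrict]
    exact hRc.continuousOn.integrableOn_compact (hKcpt.prod hKcpt)
  have hvK : volume.real K = vol e := rfl
  have h1 : ∫ y in K, ∫ x in K, R y x ≤ vol e * T := by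
    rw [hswap]
    calc _ ≤ ∫ _ in K, T := setIntegral_mono_on (hint hRI') (hint continuous_const)
          hKcpt.measurableSet hTay
      _ = vol e * T := by simp [hvK]
  have h2 : ∫ y in K, ∑ x ∈ Q, wt x * R y (refMap ref e x) ≤ (∑ x ∈ Q, wt x) * T := by
    rw [integral_finsetSum _ fun x _ => (hint (hRx _)).const_mul _, Finset.sum_mul]
    refine Finset.sum_le_sum fun x hx => ?_
    rw [integral_const_mul]
    exact mul_le_mul_of_nonneg_left (hTay _ (refMap_mem_closedCell.2 (hQ x hx))) (hwt x hx).le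
  have h3 : vol e * E ≤ vol e * (B * ((1 + (∑ x ∈ Q, wt x) / vol ref) * T)) := by
    calc vol e * E = ∫ _ in K, E := by simp [hvK]
      _ ≤ ∫ y in K, B * ((∫ x in K, R y x) +
          vol e / vol ref * ∑ x ∈ Q, wt x * R y (refMap ref e x)) :=
          integral_mono (hint continuous_const)
            (hint (continuous_const.mul (hRI.add (continuous_const.mul hRS)))) hpt
      _ = B * ((∫ y in K, ∫ x in K, R y x) +
          vol e / vol ref * ∫ y in K, ∑ x ∈ Q, wt x * R y (refMap ref e x)) := by
          rw [integral_const_mul, integral_add (hint hRI) ((hint hRS).const_mul _),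
            integral_const_mul]
      _ ≤ B * (vol e * T + vol e / vol ref * ((∑ x ∈ Q, wt x) * T)) := by gcongr
      _ = _ := by field_simp
  refine (le_of_mul_le_mul_left h3 hve).trans (le_of_eq ?_)
  rw [hT, hvK]; ring

end

/-- A Sobolev inequality on tetrahedra, for smooth functions. -/
theorem abs_le_classicalNorm (e : Tetrahedron) {m : ℕ} (hm : 2 ≤ m) {f : E3 → ℝ}
    (hf : ContDiff ℝ ∞ f) {x : E3} (hx : x ∈ closedCell e) :
    vol e * |f x| ≤ taylorConst m (max 1 (Metric.diam (closedCell e))) *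
      Real.sqrt (vol e) * classicalNorm m (closedCell e) f := by
  -- With j = 0 the Taylor sum is empty and the averaged remainder is vol e * |f x|.
  have h := integral_abs_sub_taylorSum_le (isCompact_closedCell e) (convex_closedCell e) hm
    (Nat.zero_le m) (le_max_left 1 _) (le_max_right 1 _) hf hx
  simpa [taylorSum, vol] using h

open Filter Topology

/-! ### Smoothing by contraction and mollification -/

/-- `η`, followed by the contraction `x ↦ a + t x`, smooths functions on the cell `e`, with
displacement at most `δ`. -/
structure IsSmoothingKernel (e : Tetrahedron) (η : E3 → ℝ) (a : E3) (t δ : ℝ) : Prop where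
  contDiff : ContDiff ℝ ∞ η
  hasCompactSupport : HasCompactSupport η
  nonneg : ∀ x, 0 ≤ η x
  integral_eq_one : ∫ x, η x = 1
  half_le : 1 / 2 ≤ t
  le_one : t ≤ 1
  one_sub_le : 1 - t ≤ δ
  tsupport_subset : ∀ x ∈ closedCell e, tsupport (fun y => η (a + t • x - y)) ⊆ openCell e
  dist_le : ∀ x ∈ closedCell e, ∀ y, η (a + t • x - y) ≠ 0 → dist y x ≤ δ

/-- The mollification of `g` at the point `a + t x`. -/
def smoothing (η : E3 → ℝ) (a : E3) (t : ℝ) (g : E3 → ℝ) (x : E3) : ℝ :=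
  ∫ y, g y * η (a + t • x - y)

/-- Contract the cell by 1 - s towards the centre c of a ball of radius r inside it. Every image
point then has a neighbourhood of radius s r in the cell, so a mollifier of radius s r / 2 does not
see the boundary. -/
lemma exists_isSmoothingKernel (e : Tetrahedron) {δ : ℝ} (hδ : 0 < δ) :
    ∃ η a t, IsSmoothingKernel e η a t δ := by
  obtain ⟨c, hc⟩ := openCell_nonempty e
  obtain ⟨r, hr, hball⟩ := Metric.isOpen_iff.1 (isOpen_openCell e) c hc
  set d := Metric.diam (closedCell e) with hd
  have hd0 : 0 ≤ d := Metric.diam_nonneg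
  -- The first bound keeps the contraction ratio at least 1/2; the second makes the displacement, at
  -- most s r / 2 + s d, smaller than δ.
  set s := min (1 / 2) (δ / (r + d + 1)) with hs
  have hs0 : 0 < s := by positivity
  have hs1 : s ≤ 1 / 2 := min_le_left _ _
  have hs2 : s * (r + d + 1) ≤ δ := by
    rw [← le_div_iff₀ (by positivity)]; exact min_le_right _ _
  let ρ : ContDiffBump (0 : E3) := ⟨s * r / 4, s * r / 2, by positivity, by
    have : 0 < s * r := by positivity
    linarith⟩
  have hsupp : ∀ (x y : E3), y ∈ tsupport (fun y => ρ.normed volume (c - (1 - s) • c + (1 - s) • x - y)) →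
      ‖c - (1 - s) • c + (1 - s) • x - y‖ ≤ s * r / 2 := by
    intro x y hy
    have hsub : tsupport (fun y => ρ.normed volume (c - (1 - s) • c + (1 - s) • x - y)) ⊆
        (fun y => c - (1 - s) • c + (1 - s) • x - y) ⁻¹' tsupport (ρ.normed volume) :=
      tsupport_comp_subset_preimage (f := fun y => c - (1 - s) • c + (1 - s) • x - y)
        (ρ.normed volume) (by fun_prop)
    have := hsub hy
    rw [mem_preimage, ρ.tsupport_normed_eq] at this
    simpa using this
  refine ⟨ρ.normed volume, c - (1 - s) • c, 1 - s, ρ.contDiff_normed, ρ.hasCompactSupport_normed,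
    ρ.nonneg_normed, ρ.integral_normed, by linarith, by linarith, by nlinarith, ?_, ?_⟩
  · intro x hx y hy
    have h := hsupp x y hy
    set z := c - (1 - s) • c + (1 - s) • x - y with hz
    -- A point y of the support is s (c - z/s) + (1 - s) x, a convex combination of an interior
    -- point and a point of the closed cell.
    have hw : c - s⁻¹ • z ∈ openCell e := by
      apply hball
      rw [Metric.mem_ball, dist_eq_norm]
      have : ‖c - s⁻¹ • z - c‖ = s⁻¹ * ‖z‖ := by
        rw [sub_sub_cancel_left, norm_neg, norm_smul, Real.norm_of_nonneg (by positivity)]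
      rw [this]
      calc s⁻¹ * ‖z‖ ≤ s⁻¹ * (s * r / 2) := by gcongr
        _ = r / 2 := by field_simp
        _ < r := by linarith
    have h2 := (convex_closedCell e).combo_interior_self_mem_interior hw hx hs0
      (show 0 ≤ 1 - s by linarith) (by ring)
    have h3 : s • (c - s⁻¹ • z) + (1 - s) • x = y := by
      rw [smul_sub, smul_smul, mul_inv_cancel₀ hs0.ne', hz]; module
    rwa [h3] at h2
  · intro x hx y hy
    have h := hsupp x y (subset_tsupport _ hy)
    have h1 : ‖x - c‖ ≤ d := by
      rw [← dist_eq_norm]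
      exact Metric.dist_le_diam_of_mem (isCompact_closedCell e).isBounded hx (openCell_subset e hc)
    have h2 : y - x = -(c - (1 - s) • c + (1 - s) • x - y) - s • (x - c) := by module
    rw [dist_eq_norm, h2]
    calc _ ≤ ‖-(c - (1 - s) • c + (1 - s) • x - y)‖ + ‖s • (x - c)‖ := norm_sub_le _ _
      _ ≤ s * r / 2 + s * d := by
          rw [norm_neg, norm_smul, Real.norm_of_nonneg hs0.le]; gcongr
      _ ≤ δ := by nlinarith

/-! ### Mollification, its derivatives and its convergence in L². -/

lemma smoothing_eq_convolution (η : E3 → ℝ) (a : E3) (t : ℝ) (g : E3 → ℝ) (x : E3) :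
    smoothing η a t g x = (convolution g η (ContinuousLinearMap.mul ℝ ℝ) volume) (a + t • x) := by
  simp [smoothing, convolution_def]

lemma integrable_mul_kernel {η g : E3 → ℝ} (hη : Continuous η) (hηc : HasCompactSupport η)
    (hg : LocallyIntegrable g) (z : E3) : Integrable fun y => g y * η (z - y) :=
  hηc.convolutionExists_right (ContinuousLinearMap.mul ℝ ℝ) hg hη z

lemma contDiff_convolution {η g : E3 → ℝ} (hη : ContDiff ℝ ∞ η) (hηc : HasCompactSupport η)
    (hg : LocallyIntegrable g) :
    ContDiff ℝ ∞ (convolution g η (ContinuousLinearMap.mul ℝ ℝ) volume) :=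
  hηc.contDiff_convolution_right (n := ⊤) _ hg hη

lemma hasCompactSupport_partialDeriv {η : E3 → ℝ} (hηc : HasCompactSupport η) (k : Fin 3) :
    HasCompactSupport (partialDeriv k η) := by
  refine (hηc.fderiv ℝ).mono fun x hx h => hx ?_
  rw [partialDeriv, h]; rfl

lemma hasCompactSupport_multiDeriv {η : E3 → ℝ} (hη : ContDiff ℝ ∞ η)
    (hηc : HasCompactSupport η) (α : Fin 3 → ℕ) : HasCompactSupport (multiDeriv α η) := by
  induction α using multiIndex_induction with
  | h0 => exact hηc
  | hs α k ih =>
    rw [multiDeriv_add_single α k hη]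
    exact hasCompactSupport_partialDeriv ih k

lemma multiDeriv_convolution {η g : E3 → ℝ} (hη : ContDiff ℝ ∞ η) (hηc : HasCompactSupport η)
    (hg : LocallyIntegrable g) (α : Fin 3 → ℕ) :
    multiDeriv α (convolution g η (ContinuousLinearMap.mul ℝ ℝ) volume) =
      convolution g (multiDeriv α η) (ContinuousLinearMap.mul ℝ ℝ) volume := by
  induction α using multiIndex_induction with
  | h0 => rfl
  | hs α k ih =>
    have hα := contDiff_multiDeriv α hη
    have hαc := hasCompactSupport_multiDeriv hη hηc α
    rw [multiDeriv_add_single α k hη, multiDeriv_add_single α k (contDiff_convolution hη hηc hg), ih]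
    funext x
    rw [partialDeriv, (hαc.hasFDerivAt_convolution_right _ hg (hα.of_le (by simp)) x).fderiv,
      convolution_precompR_apply _ hg (hαc.fderiv ℝ) (hα.continuous_fderiv (by simp))]
    rfl

lemma contDiff_smoothing {η g : E3 → ℝ} (hη : ContDiff ℝ ∞ η) (hηc : HasCompactSupport η)
    (hg : LocallyIntegrable g) (a : E3) (t : ℝ) : ContDiff ℝ ∞ (smoothing η a t g) := by
  rw [show smoothing η a t g = fun x => _ from funext fun x => smoothing_eq_convolution η a t g x]
  exact (contDiff_convolution hη hηc hg).comp (contDiff_const.add (contDiff_const_smul t))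

/-- Derivatives of the smoothing are smoothings of the weak derivatives. -/
lemma multiDeriv_smoothing {e : Tetrahedron} {η : E3 → ℝ} {a : E3} {t δ : ℝ}
    (h : IsSmoothingKernel e η a t δ) {α : Fin 3 → ℕ} {u g : E3 → ℝ}
    (hu : LocallyIntegrable ((openCell e).indicator u)) (hw : IsWeakDeriv (openCell e) α u g)
    {x : E3} (hx : x ∈ closedCell e) :
    multiDeriv α (smoothing η a t ((openCell e).indicator u)) x =
      t ^ (∑ i, α i) * smoothing η a t ((openCell e).indicator g) x := by
  have hη := h.contDiff
  have hm := (isOpen_openCell e).measurableSet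
  rw [show smoothing η a t ((openCell e).indicator u) = fun x => _ from
    funext fun x => smoothing_eq_convolution η a t _ x,
    multiDeriv_comp_dilation α (contDiff_convolution hη h.hasCompactSupport hu),
    multiDeriv_convolution hη h.hasCompactSupport hu]
  set z := a + t • x with hz
  -- Because the contraction has moved z inwards, the reflected kernel is a test function in the
  -- open cell even for x on the boundary; extension by zero therefore creates no boundary terms.
  have htest : IsTestFunction (openCell e) fun y => η (z - y) := by
    refine ⟨hη.comp (contDiff_const.sub contDiff_id), ?_, h.tsupport_subset x hx⟩
    exact h.hasCompactSupport.comp_homeomorph (Homeomorph.subLeft z)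
  have h1 := hw.2.2 _ htest
  have h2 : multiDeriv α (fun y => η (z - y)) =
      fun y => (-1) ^ (∑ i, α i) * multiDeriv α η (z - y) := by
    have := multiDeriv_comp_dilation α hη z (-1)
    simpa [sub_eq_add_neg] using this
  rw [h2] at h1
  have h3 : ∀ f ψ : E3 → ℝ, ∫ y in openCell e, f y * ψ (z - y) =
      ∫ y, (openCell e).indicator f y * ψ (z - y) := by
    intro f ψ
    rw [← integral_indicator hm]
    congr 1; funext y
    by_cases hy : y ∈ openCell e <;> simp [hy]
  -- The sign from reflecting the kernel cancels the sign in the definition of the weak derivative.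
  have hs : ((-1 : ℝ) ^ (∑ i, α i)) * (-1) ^ (∑ i, α i) = 1 := by
    rw [← mul_pow]; simp
  have h4 : ∫ y in openCell e, u y * ((-1) ^ (∑ i, α i) * multiDeriv α η (z - y)) =
      (-1) ^ (∑ i, α i) * ∫ y in openCell e, u y * multiDeriv α η (z - y) := by
    rw [← integral_const_mul]; congr 1; funext y; ring
  rw [h4] at h1
  have h5 := congrArg (fun s => (-1 : ℝ) ^ (∑ i, α i) * s) h1
  simp only [← mul_assoc, hs, one_mul] at h5
  rw [h3 u (multiDeriv α η), h3 g η] at h5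
  exact congrArg (fun s => t ^ (∑ i, α i) * s) h5

/-- Smoothing is bounded on `L²`. -/
lemma integral_smoothing_sq_le {e : Tetrahedron} {η : E3 → ℝ} {a : E3} {t δ : ℝ}
    (h : IsSmoothingKernel e η a t δ) {g : E3 → ℝ} (hg : Integrable g)
    (hg2 : Integrable fun x => g x ^ 2) :
    ∫ x in closedCell e, smoothing η a t g x ^ 2 ≤ 8 * ∫ x, g x ^ 2 := by
  set L := ContinuousLinearMap.mul ℝ ℝ
  have hηi : Integrable η := h.contDiff.continuous.integrable_of_hasCompactSupport h.hasCompactSupport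
  have ht : 0 < t := by linarith [h.half_le]
  have hη1 : ∀ z, ∫ y, η (z - y) = 1 := fun z => by
    rw [integral_sub_left_eq_self η volume z, h.integral_eq_one]
  -- Jensen's inequality for the probability density η(z - ·).
  have hpt : ∀ z, (convolution g η L volume) z ^ 2 ≤
      (convolution (fun x => g x ^ 2) η L volume) z := by
    intro z
    have h1 := integrable_mul_kernel h.contDiff.continuous h.hasCompactSupport
      hg.locallyIntegrable z
    have h2 := integrable_mul_kernel h.contDiff.continuous h.hasCompactSupport
      hg2.locallyIntegrable z
    have := sq_integral_mul_le (μ := volume) (ρ := fun y => η (z - y)) (F := g)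
      (fun y => h.nonneg _) (hηi.comp_sub_left z) (by simpa [mul_comm] using h1)
      (by simpa [mul_comm] using h2)
    rw [hη1, one_mul] at this
    simpa [convolution_def, L, mul_comm] using this
  have hci : Integrable (convolution (fun x => g x ^ 2) η L volume) :=
    hg2.integrable_convolution L hηi
  have hcv := contDiff_convolution h.contDiff h.hasCompactSupport hg.locallyIntegrable
  have hsq : Integrable fun z => (convolution g η L volume) z ^ 2 := by
    refine hci.mono' (hcv.continuous.pow 2).aestronglyMeasurable (ae_of_all _ fun z => ?_)
    rw [Real.norm_of_nonneg (sq_nonneg _)]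
    exact hpt z
  have hle : ∫ z, (convolution g η L volume) z ^ 2 ≤ ∫ x, g x ^ 2 := by
    refine (integral_mono hsq hci hpt).trans (le_of_eq ?_)
    rw [integral_convolution L hg2 hηi, h.integral_eq_one]
    simp [L]
  simp_rw [smoothing_eq_convolution]
  have hcomp : Integrable fun x => (convolution g η L volume) (a + t • x) ^ 2 :=
    (hsq.comp_add_left a).comp_smul ht.ne'
  have h0 : 0 ≤ ∫ x, g x ^ 2 := integral_nonneg fun x => sq_nonneg _
  have ht2 : t⁻¹ ^ 3 ≤ 8 := by
    have : t⁻¹ ≤ 2 := by rw [inv_le_comm₀ ht two_pos]; linarith [h.half_le]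
    calc t⁻¹ ^ 3 ≤ 2 ^ 3 := by gcongr
      _ = 8 := by norm_num
  calc _ ≤ ∫ x, (convolution g η L volume) (a + t • x) ^ 2 :=
        setIntegral_le_integral hcomp (ae_of_all _ fun x => sq_nonneg _)
    _ = t⁻¹ ^ 3 * ∫ z, (convolution g η L volume) z ^ 2 :=
        integral_comp_affine (fun z => (convolution g η L volume) z ^ 2) ht a
    _ ≤ t⁻¹ ^ 3 * ∫ x, g x ^ 2 := by gcongr
    _ ≤ 8 * ∫ x, g x ^ 2 := by gcongr

/-- The kernel has mass one and only involves points within δ of x, so the smoothing is an average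
of nearby values. -/
lemma abs_smoothing_sub_le {e : Tetrahedron} {η : E3 → ℝ} {a : E3} {t δ : ℝ}
    (h : IsSmoothingKernel e η a t δ) {g : E3 → ℝ} (hg : LocallyIntegrable g) {x : E3}
    (hx : x ∈ closedCell e) {b : ℝ} (hb : ∀ y, dist y x ≤ δ → |g y - g x| ≤ b) :
    |smoothing η a t g x - g x| ≤ b := by
  set z := a + t • x with hz
  have hηi : Integrable fun y => η (z - y) :=
    (h.contDiff.continuous.integrable_of_hasCompactSupport h.hasCompactSupport).comp_sub_left z
  have hη1 : ∫ y, η (z - y) = 1 := by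
    rw [integral_sub_left_eq_self η volume z, h.integral_eq_one]
  have h1 := integrable_mul_kernel h.contDiff.continuous h.hasCompactSupport hg z
  have e1 : smoothing η a t g x - g x = ∫ y, (g y - g x) * η (z - y) := by
    simp_rw [sub_mul]
    rw [integral_sub h1 (hηi.const_mul _), integral_const_mul, hη1, mul_one]
    rfl
  rw [e1]
  calc _ ≤ ∫ y, b * η (z - y) := by
        rw [← Real.norm_eq_abs]
        refine norm_integral_le_of_norm_le (hηi.const_mul b) (ae_of_all _ fun y => ?_)
        rw [norm_mul, Real.norm_eq_abs, Real.norm_of_nonneg (h.nonneg _)]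
        by_cases hy : η (z - y) = 0
        · simp [hy]
        · exact mul_le_mul_of_nonneg_right (hb y (h.dist_le x hx y hy)) (h.nonneg _)
    _ = b := by rw [integral_const_mul, hη1, mul_one]

/-- Smoothings converge in `L²`. -/
lemma tendsto_integral_smoothing_sub_sq {e : Tetrahedron} {η : ℕ → E3 → ℝ} {a : ℕ → E3}
    {t δ : ℕ → ℝ} (h : ∀ n, IsSmoothingKernel e (η n) (a n) (t n) (δ n))
    (hδ : Tendsto δ atTop (𝓝 0)) {g : E3 → ℝ} (hg : Integrable g) (hg2 : MemLp g 2) :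
    Tendsto (fun n => ∫ x in closedCell e, (smoothing (η n) (a n) (t n) g x - g x) ^ 2) atTop
      (𝓝 0) := by
  have hsq : ∀ {f : E3 → ℝ}, MemLp f 2 → Integrable fun x => f x ^ 2 := fun hf =>
    (memLp_two_iff_integrable_sq hf.1).1 hf
  rw [Metric.tendsto_atTop]
  intro ε hε
  set v := vol e with hv
  have hvpos : 0 < v := vol_pos e
  -- Approximate g by a continuous f of compact support. In the splitting S g - g = S(g - f) + (S f
  -- - f) - (g - f), the tolerances add up to 3(8/81 + 1/9)ε + (3/81)ε = (2/3)ε.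
  obtain ⟨f, hfc, hfε, hf, hf2⟩ := MemLp.exists_hasCompactSupport_integral_rpow_sub_le (p := 2)
    two_pos (f := g) (by simpa using hg2) (ε := ε / 81) (by positivity)
  have hf2 : MemLp f 2 := by simpa using hf2
  have hfi : Integrable f := hf.integrable_of_hasCompactSupport hfc
  have hfε' : ∫ x, (g x - f x) ^ 2 ≤ ε / 81 := by
    simpa using hfε
  set b := Real.sqrt (ε / (9 * v)) with hb
  have hbpos : 0 < b := Real.sqrt_pos.2 (by positivity)
  have hb2 : b ^ 2 = ε / (9 * v) := Real.sq_sqrt (by positivity)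
  obtain ⟨δ₀, hδ₀, huc⟩ := Metric.uniformContinuous_iff.1
    (hfc.uniformContinuous_of_continuous hf) b hbpos
  obtain ⟨N, hN⟩ := (Metric.tendsto_atTop.1 hδ) δ₀ hδ₀
  refine ⟨N, fun n hn => ?_⟩
  have hK := h n
  have hδn : δ n < δ₀ := lt_of_abs_lt (by simpa using hN n hn)
  rw [dist_zero_right, Real.norm_of_nonneg (integral_nonneg fun x => sq_nonneg _)]
  set S := smoothing (η n) (a n) (t n) with hS
  have hc : ∀ {q : E3 → ℝ}, Integrable q → Continuous (S q) := fun hq =>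
    (contDiff_smoothing hK.contDiff hK.hasCompactSupport hq.locallyIntegrable _ _).continuous
  have hd2 : MemLp (fun x => g x - f x) 2 := hg2.sub hf2
  have hlin : ∀ x, S g x = S (fun y => g y - f y) x + S f x := by
    intro x
    simp only [hS, smoothing, sub_mul]
    rw [integral_sub (integrable_mul_kernel hK.contDiff.continuous hK.hasCompactSupport
      hg.locallyIntegrable _) (integrable_mul_kernel hK.contDiff.continuous hK.hasCompactSupport
      hfi.locallyIntegrable _), sub_add_cancel]
  have hA := integral_smoothing_sq_le hK (hg.sub hfi) (hsq hd2)
  have hAi : IntegrableOn (fun x => S (fun y => g y - f y) x ^ 2) (closedCell e) :=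
    integrableOn e ((hc (hg.sub hfi)).pow 2).continuousOn
  have hBi : IntegrableOn (fun x => (S f x - f x) ^ 2) (closedCell e) :=
    integrableOn e (((hc hfi).sub hf).pow 2).continuousOn
  have hCi : IntegrableOn (fun x => (g x - f x) ^ 2) (closedCell e) := (hsq hd2).integrableOn
  have hB : ∫ x in closedCell e, (S f x - f x) ^ 2 ≤ ε / 9 := by
    calc _ ≤ ∫ _ in closedCell e, b ^ 2 := by
          refine setIntegral_mono_on hBi (integrableOn e continuousOn_const)
            (isCompact_closedCell e).measurableSet fun x hx => ?_
          rw [← sq_abs]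
          gcongr
          refine abs_smoothing_sub_le hK hfi.locallyIntegrable hx fun y hy => ?_
          exact (huc (hy.trans_lt hδn)).le
      _ = v * b ^ 2 := by simp [hv, vol]
      _ = ε / 9 := by rw [hb2]; field_simp
  have hC : ∫ x in closedCell e, (g x - f x) ^ 2 ≤ ε / 81 :=
    (setIntegral_le_integral (hsq hd2) (ae_of_all _ fun x => sq_nonneg _)).trans hfε'
  calc _ ≤ ∫ x in closedCell e, (3 * (S (fun y => g y - f y) x ^ 2 + (S f x - f x) ^ 2) +
        3 * (g x - f x) ^ 2) := by
        refine integral_mono_of_nonneg (ae_of_all _ fun x => sq_nonneg _)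
          (((hAi.add hBi).const_mul 3).add (hCi.const_mul 3)) (ae_of_all _ fun x => ?_)
        dsimp only
        rw [hlin]
        nlinarith [sq_nonneg (S (fun y => g y - f y) x - (S f x - f x)),
          sq_nonneg (S (fun y => g y - f y) x + (g x - f x)),
          sq_nonneg ((S f x - f x) + (g x - f x))]
    _ = 3 * ((∫ x in closedCell e, S (fun y => g y - f y) x ^ 2) +
          ∫ x in closedCell e, (S f x - f x) ^ 2) + 3 * ∫ x in closedCell e, (g x - f x) ^ 2 := by
        rw [integral_add (f := fun x => 3 * (S (fun y => g y - f y) x ^ 2 + (S f x - f x) ^ 2))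
          ((hAi.add hBi).const_mul 3) (hCi.const_mul 3), integral_const_mul,
          integral_add hAi hBi, integral_const_mul]
    _ ≤ 3 * (8 * (ε / 81) + ε / 9) + 3 * (ε / 81) := by
        have : ∫ x in closedCell e, S (fun y => g y - f y) x ^ 2 ≤ 8 * (ε / 81) :=
          hA.trans (by gcongr; exact hfε')
        gcongr
    _ < ε := by linarith

/-! ### Weak derivatives -/

lemma tsupport_partialDeriv_subset (k : Fin 3) (φ : E3 → ℝ) :
    tsupport (partialDeriv k φ) ⊆ tsupport φ := by
  have h : Function.support (partialDeriv k φ) ⊆ Function.support (fderiv ℝ φ) :=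
    fun x hx h => hx (by rw [partialDeriv, h]; rfl)
  exact (closure_mono h).trans (tsupport_fderiv_subset ℝ)

lemma IsTestFunction.partialDeriv {V : Set E3} {φ : E3 → ℝ} (hφ : IsTestFunction V φ) (k : Fin 3) :
    IsTestFunction V (MassLumping.partialDeriv k φ) :=
  ⟨contDiff_partialDeriv hφ.1 k, hasCompactSupport_partialDeriv hφ.2.1 k,
    (tsupport_partialDeriv_subset k φ).trans hφ.2.2⟩

lemma IsTestFunction.multiDeriv {V : Set E3} {φ : E3 → ℝ} (hφ : IsTestFunction V φ)
    (α : Fin 3 → ℕ) : IsTestFunction V (MassLumping.multiDeriv α φ) := by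
  induction α using multiIndex_induction with
  | h0 => exact hφ
  | hs α k ih =>
    rw [multiDeriv_add_single α k hφ.1]
    exact ih.partialDeriv k

lemma IsTestFunction.mono {V V' : Set E3} {φ : E3 → ℝ} (hφ : IsTestFunction V' φ)
    (h : V' ⊆ V) : IsTestFunction V φ := ⟨hφ.1, hφ.2.1, hφ.2.2.trans h⟩

lemma IsTestFunction.eq_zero {V : Set E3} {φ : E3 → ℝ} (hφ : IsTestFunction V φ) {x : E3}
    (hx : x ∉ V) : φ x = 0 := image_eq_zero_of_notMem_tsupport fun h => hx (hφ.2.2 h)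

lemma IsTestFunction.setIntegral_mul {V : Set E3} {φ : E3 → ℝ} (hφ : IsTestFunction V φ)
    (f : E3 → ℝ) : ∫ x in V, f x * φ x = ∫ x, f x * φ x :=
  setIntegral_eq_integral_of_forall_compl_eq_zero fun x hx => by rw [hφ.eq_zero hx, mul_zero]

lemma IsTestFunction.integrable_mul {V : Set E3} {φ g : E3 → ℝ} (hφ : IsTestFunction V φ)
    (hg : LocallyIntegrableOn g V) : Integrable fun x => g x * φ x := by
  have h1 : IntegrableOn g (tsupport φ) := hg.integrableOn_compact_subset hφ.2.2 hφ.2.1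
  have h2 : IntegrableOn (fun x => g x * φ x) (tsupport φ) :=
    h1.mul_continuousOn hφ.1.continuous.continuousOn hφ.2.1
  refine (integrableOn_iff_integrable_of_support_subset fun x hx => ?_).1 h2
  exact subset_tsupport _ (right_ne_zero_of_mul hx)

/-- The fundamental lemma of the calculus of variations, applied to g - g'. -/
lemma IsWeakDeriv.ae_eq {V : Set E3} (hV : IsOpen V) {α : Fin 3 → ℕ} {u g g' : E3 → ℝ}
    (h : IsWeakDeriv V α u g) (h' : IsWeakDeriv V α u g') :
    g =ᵐ[volume.restrict V] g' := by
  have hloc : LocallyIntegrableOn (fun x => g x - g' x) V := h.2.1.sub h'.2.1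
  have key := hV.ae_eq_zero_of_integral_contDiff_smul_eq_zero (μ := volume) hloc ?_
  · rw [Filter.EventuallyEq, ae_restrict_iff' hV.measurableSet]
    filter_upwards [key] with x hx hxV
    linarith [hx hxV]
  · intro φ h1 h2 h3
    have hφ : IsTestFunction V φ := ⟨h1, h2, h3⟩
    have e := (h.2.2 φ hφ).symm.trans (h'.2.2 φ hφ)
    have hs : ((-1 : ℝ) ^ (∑ i, α i)) ≠ 0 := by simp
    have e2 := mul_left_cancel₀ hs e
    rw [hφ.setIntegral_mul, hφ.setIntegral_mul] at e2
    have e3 := integral_sub (hφ.integrable_mul h.2.1) (hφ.integrable_mul h'.2.1)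
    rw [e2, sub_self] at e3
    rw [← e3]
    congr 1; funext x
    simp only [smul_eq_mul]; ring

/-- A test function on the smaller set is one on the larger set, and its integrals over either set
are integrals over the whole space. -/
lemma IsWeakDeriv.mono {V V' : Set E3} (hVV : V' ⊆ V) {α : Fin 3 → ℕ} {u g : E3 → ℝ}
    (h : IsWeakDeriv V α u g) : IsWeakDeriv V' α u g := by
  refine ⟨h.1.mono_set hVV, h.2.1.mono_set hVV, fun φ hφ => ?_⟩
  have h1 := h.2.2 φ (hφ.mono hVV)
  rwa [((hφ.mono hVV).multiDeriv α).setIntegral_mul, (hφ.mono hVV).setIntegral_mul,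
    ← (hφ.multiDeriv α).setIntegral_mul, ← hφ.setIntegral_mul] at h1

lemma IsWeakDeriv.congr {V : Set E3} {α : Fin 3 → ℕ} {u u' g : E3 → ℝ}
    (h : IsWeakDeriv V α u g) (hu : LocallyIntegrableOn u' V)
    (he : u =ᵐ[volume.restrict V] u') : IsWeakDeriv V α u' g := by
  refine ⟨hu, h.2.1, fun φ hφ => ?_⟩
  rw [← h.2.2 φ hφ]
  refine integral_congr_ae ?_
  filter_upwards [he] with x hx
  rw [hx]

/-- Integration by parts, one derivative at a time; each step contributes one sign. -/
lemma isWeakDeriv_multiDeriv {V : Set E3} {f : E3 → ℝ} (hf : ContDiff ℝ ∞ f) (α : Fin 3 → ℕ) :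
    IsWeakDeriv V α f (multiDeriv α f) := by
  have hloc : ∀ {g : E3 → ℝ}, Continuous g → LocallyIntegrableOn g V := fun hg =>
    hg.locallyIntegrable.locallyIntegrableOn V
  refine ⟨hloc hf.continuous, hloc (contDiff_multiDeriv α hf).continuous, ?_⟩
  induction α using multiIndex_induction with
  | h0 => intro φ _; simp [multiDeriv_zero]
  | hs α k ih =>
    intro φ hφ
    have hα := contDiff_multiDeriv α hf
    have hφk := hφ.partialDeriv k
    rw [multiDeriv_add_single' α k hφ.1, ih _ hφk, sum_add_single, hφk.setIntegral_mul,
      hφ.setIntegral_mul, multiDeriv_add_single α k hf, pow_succ]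
    have h1 := integral_mul_fderiv_eq_neg_fderiv_mul_of_integrable (μ := volume) (𝕜 := ℝ)
      (f := multiDeriv α f) (g := φ) (v := EuclideanSpace.single k 1)
      (hφ.integrable_mul (hloc (contDiff_partialDeriv hα k).continuous))
      (hφk.integrable_mul (hloc hα.continuous)) (hφ.integrable_mul (hloc hα.continuous))
      (fun x _ => hα.differentiable (by simp) x) (fun x _ => hφ.1.differentiable (by simp) x)
    have h2 : ∫ x, multiDeriv α f x * partialDeriv k φ x =
      -∫ x, partialDeriv k (multiDeriv α f) x * φ x := h1
    rw [h2]; ring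

lemma weakDeriv_spec {V : Set E3} (hV : IsOpen V) {α : Fin 3 → ℕ} {u g : E3 → ℝ}
    (h : IsWeakDeriv V α u g) :
    IsWeakDeriv V α u (weakDeriv V α u) ∧ weakDeriv V α u =ᵐ[volume.restrict V] g := by
  have hex : ∃ g, IsWeakDeriv V α u g := ⟨g, h⟩
  have h1 : IsWeakDeriv V α u (weakDeriv V α u) := by
    rw [weakDeriv, dif_pos hex]; exact hex.choose_spec
  exact ⟨h1, h1.ae_eq hV h⟩

/-! ### Sobolev functions and their norms on open sets. -/

lemma MemH.weakDeriv_spec {V : Set E3} (hV : IsOpen V) {k : ℕ} {u : E3 → ℝ} (h : MemH k V u)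
    {α : Fin 3 → ℕ} (hα : α ∈ multiIndices k) :
    IsWeakDeriv V α u (weakDeriv V α u) ∧ MemLp (weakDeriv V α u) 2 (volume.restrict V) := by
  obtain ⟨g, hg, hg2⟩ := h α hα
  obtain ⟨h1, h2⟩ := MassLumping.weakDeriv_spec hV hg
  exact ⟨h1, (memLp_congr_ae h2).2 hg2⟩

lemma MemH.mono_order {V : Set E3} {k m : ℕ} {u : E3 → ℝ} (h : MemH k V u) (hm : m ≤ k) :
    MemH m V u := fun α hα => h α (mem_multiIndices.2 ((mem_multiIndices.1 hα).trans hm))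

lemma MemH.mono_set {V V' : Set E3} {k : ℕ} {u : E3 → ℝ} (h : MemH k V u) (hV : V' ⊆ V) :
    MemH k V' u := fun α hα => by
  obtain ⟨g, hg, hg2⟩ := h α hα
  exact ⟨g, hg.mono hV, hg2.mono_measure (Measure.restrict_mono hV le_rfl)⟩

lemma MemH.memLp {V : Set E3} (hV : IsOpen V) {k : ℕ} {u : E3 → ℝ} (h : MemH k V u) :
    MemLp u 2 (volume.restrict V) := by
  obtain ⟨g, hg, hg2⟩ := h 0 (mem_multiIndices.2 (by simp))
  have h0 : IsWeakDeriv V 0 u u := ⟨hg.1, hg.1, fun φ _ => by simp [multiDeriv_zero]⟩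
  exact (memLp_congr_ae (h0.ae_eq hV hg)).2 hg2

lemma MemH.weakDeriv_zero {V : Set E3} (hV : IsOpen V) {k : ℕ} {u : E3 → ℝ} (h : MemH k V u) :
    weakDeriv V 0 u =ᵐ[volume.restrict V] u := by
  obtain ⟨g, hg, -⟩ := h 0 (mem_multiIndices.2 (by simp))
  have h0 : IsWeakDeriv V 0 u u := ⟨hg.1, hg.1, fun φ _ => by simp [multiDeriv_zero]⟩
  exact (MassLumping.weakDeriv_spec hV h0).2

lemma sobolevNorm_sq (k : ℕ) (V : Set E3) (u : E3 → ℝ) :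
    sobolevNorm k V u ^ 2 = ∑ α ∈ multiIndices k, ∫ x in V, weakDeriv V α u x ^ 2 :=
  Real.sq_sqrt (Finset.sum_nonneg fun _ _ => integral_nonneg fun _ => sq_nonneg _)

lemma sobolevNorm_nonneg (k : ℕ) (V : Set E3) (u : E3 → ℝ) : 0 ≤ sobolevNorm k V u :=
  Real.sqrt_nonneg _

lemma classicalNorm_sq (m : ℕ) (K : Set E3) (f : E3 → ℝ) :
    classicalNorm m K f ^ 2 = ∑ α ∈ multiIndices m, ∫ x in K, multiDeriv α f x ^ 2 :=
  Real.sq_sqrt (Finset.sum_nonneg fun _ _ => integral_nonneg fun _ => sq_nonneg _)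

/-- Translates inverse inequalities, which concern the polynomial W, into the norms of the finite
element function w. -/
lemma sobolevNorm_eq_classicalNorm (e : Tetrahedron) {k : ℕ} {w W : E3 → ℝ}
    (hw : LocallyIntegrableOn w (openCell e)) (hW : ContDiff ℝ ∞ W)
    (h : w =ᵐ[volume.restrict (openCell e)] W) :
    sobolevNorm k (openCell e) w = classicalNorm k (closedCell e) W := by
  rw [sobolevNorm, classicalNorm]
  congr 1
  refine Finset.sum_congr rfl fun α _ => ?_
  have h1 : IsWeakDeriv (openCell e) α w (multiDeriv α W) :=
    (isWeakDeriv_multiDeriv hW α).congr hw h.symm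
  rw [← restrict_openCell]
  refine integral_congr_ae ?_
  filter_upwards [(weakDeriv_spec (isOpen_openCell e) h1).2] with x hx
  rw [hx]

/-! ### Approximation by smooth functions, and the continuous representative -/

lemma Tetrahedron.memLp_of_continuousOn (e : Tetrahedron) {g : E3 → ℝ}
    (hg : ContinuousOn g (closedCell e)) : MemLp g 2 (volume.restrict (closedCell e)) :=
  (memLp_two_iff_integrable_sq (integrableOn e hg).1).2 (integrableOn e (hg.pow 2))

lemma integral_sub_sq_le {μ : Measure E3} {f g h : E3 → ℝ} (hf : MemLp f 2 μ) (hg : MemLp g 2 μ)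
    (hh : MemLp h 2 μ) : ∫ x, (f x - g x) ^ 2 ∂μ ≤
      2 * ((∫ x, (f x - h x) ^ 2 ∂μ) + ∫ x, (g x - h x) ^ 2 ∂μ) := by
  have hsq : ∀ {f : E3 → ℝ}, MemLp f 2 μ → Integrable (fun x => f x ^ 2) μ := fun hf =>
    (memLp_two_iff_integrable_sq hf.1).1 hf
  have h1 := hsq (hf.sub hh)
  have h2 := hsq (hg.sub hh)
  simp only [Pi.sub_apply] at h1 h2
  rw [← integral_add h1 h2, ← integral_const_mul]
  refine integral_mono_of_nonneg (ae_of_all _ fun x => sq_nonneg _) ((h1.add h2).const_mul 2)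
    (ae_of_all _ fun x => ?_)
  dsimp only
  nlinarith [sq_nonneg ((f x - h x) + (g x - h x))]

/-- The factor t^k is the chain-rule factor of the contraction; it tends to 1 because 1 - δ ≤ t ≤ 1.
-/
lemma tendsto_integral_const_mul_smoothing {e : Tetrahedron} {η : ℕ → E3 → ℝ} {a : ℕ → E3}
    {t δ : ℕ → ℝ} (h : ∀ n, IsSmoothingKernel e (η n) (a n) (t n) (δ n))
    (hδ : Tendsto δ atTop (𝓝 0)) {g : E3 → ℝ} (hg : Integrable g) (hg2 : MemLp g 2) (k : ℕ) :
    Tendsto (fun n => ∫ x in closedCell e,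
      (t n ^ k * smoothing (η n) (a n) (t n) g x - g x) ^ 2) atTop (𝓝 0) := by
  have hsq : ∀ {f : E3 → ℝ}, MemLp f 2 (volume.restrict (closedCell e)) →
      Integrable (fun x => f x ^ 2) (volume.restrict (closedCell e)) := fun hf =>
    (memLp_two_iff_integrable_sq hf.1).1 hf
  have ht : Tendsto t atTop (𝓝 1) := by
    have h1 : Tendsto (fun n => 1 - δ n) atTop (𝓝 1) := by simpa using hδ.const_sub 1
    exact tendsto_of_tendsto_of_tendsto_of_le_of_le h1 tendsto_const_nhds
      (fun n => by linarith [(h n).one_sub_le]) (fun n => (h n).le_one)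
  have hgK : MemLp g 2 (volume.restrict (closedCell e)) := hg2.restrict _
  have hlim := tendsto_integral_smoothing_sub_sq h hδ hg hg2
  have hb : Tendsto (fun n => 2 * ((∫ x in closedCell e, (smoothing (η n) (a n) (t n) g x - g x) ^ 2)
      + (t n ^ k - 1) ^ 2 * ∫ x in closedCell e, g x ^ 2)) atTop (𝓝 0) := by
    have h2 : Tendsto (fun n => (t n ^ k - 1) ^ 2 * ∫ x in closedCell e, g x ^ 2) atTop (𝓝 0) := by
      simpa using (((ht.pow k).sub_const 1).pow 2).mul_const (∫ x in closedCell e, g x ^ 2)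
    simpa using (hlim.add h2).const_mul 2
  refine tendsto_of_tendsto_of_tendsto_of_le_of_le tendsto_const_nhds hb
    (fun n => integral_nonneg fun x => sq_nonneg _) fun n => ?_
  have hc := (contDiff_smoothing (h n).contDiff (h n).hasCompactSupport hg.locallyIntegrable
    (a n) (t n)).continuous
  have hS : MemLp (smoothing (η n) (a n) (t n) g) 2 (volume.restrict (closedCell e)) :=
    memLp_of_continuousOn e hc.continuousOn
  have hi1 := hsq (hS.sub hgK)
  have hi2 := hsq hgK
  simp only [Pi.sub_apply] at hi1
  have ht0 : 0 ≤ t n ^ k := by have := (h n).half_le; positivity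
  have ht1 : t n ^ k ≤ 1 := pow_le_one₀ (by linarith [(h n).half_le]) (h n).le_one
  dsimp only
  rw [← integral_const_mul, ← integral_add hi1 (hi2.const_mul _), ← integral_const_mul]
  refine integral_mono_of_nonneg (ae_of_all _ fun x => sq_nonneg _)
    ((hi1.add (hi2.const_mul _)).const_mul 2) (ae_of_all _ fun x => ?_)
  dsimp only
  set T := t n ^ k
  set s := smoothing (η n) (a n) (t n) g x
  have e1 : T * s - g x = T * (s - g x) + (T - 1) * g x := by ring
  rw [e1]
  have hT2 : T ^ 2 ≤ 1 := pow_le_one₀ ht0 ht1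
  have h3 : (T * (s - g x)) ^ 2 ≤ (s - g x) ^ 2 := by
    rw [mul_pow]; exact mul_le_of_le_one_left (sq_nonneg _) hT2
  nlinarith [sq_nonneg (T * (s - g x) - (T - 1) * g x)]

/-- Functions in `H^m` on a tetrahedron, `m ≥ 2`, have a continuous representative, which is a
uniform limit of smooth functions that are bounded in the `H^m` norm. -/
theorem MemH.exists_smooth_approx (e : Tetrahedron) {m : ℕ} (hm : 2 ≤ m) {u : E3 → ℝ}
    (hu : MemH m (openCell e) u) : ∃ (f : ℕ → E3 → ℝ) (v : E3 → ℝ), (∀ n, ContDiff ℝ ∞ (f n)) ∧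
      ContinuousOn v (closedCell e) ∧ v =ᵐ[volume.restrict (openCell e)] u ∧
      TendstoUniformlyOn f v atTop (closedCell e) ∧
      ∀ n, classicalNorm m (closedCell e) (f n) ≤ 3 * sobolevNorm m (openCell e) u := by
  set V := openCell e with hV
  set K := closedCell e with hK
  have hVo : IsOpen V := isOpen_openCell e
  have hfin : IsFiniteMeasure (volume.restrict V) := by
    rw [hV, restrict_openCell]
    exact ⟨by simpa using (isCompact_closedCell e).measure_lt_top⟩
  set G : (Fin 3 → ℕ) → E3 → ℝ := fun α => V.indicator (weakDeriv V α u) with hG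
  have hGL : ∀ α ∈ multiIndices m, MemLp (G α) 2 := fun α hα =>
    (memLp_indicator_iff_restrict hVo.measurableSet).2 (hu.weakDeriv_spec hVo hα).2
  have hGI : ∀ α ∈ multiIndices m, Integrable (G α) := fun α hα =>
    IntegrableOn.integrable_indicator
      (MemLp.integrable (by norm_num) (hu.weakDeriv_spec hVo hα).2) hVo.measurableSet
  have h0mem : (0 : Fin 3 → ℕ) ∈ multiIndices m := mem_multiIndices.2 (by simp)
  have huI : Integrable (V.indicator u) :=
    IntegrableOn.integrable_indicator
      (MemLp.integrable (by norm_num) (hu.memLp hVo)) hVo.measurableSet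
  have hGsq : ∀ α, ∫ x, G α x ^ 2 = ∫ x in V, weakDeriv V α u x ^ 2 := by
    intro α
    rw [← integral_indicator hVo.measurableSet]
    congr 1; funext x
    by_cases hx : x ∈ V <;> simp [hG, hx]
  choose η a t hη using fun n : ℕ =>
    exists_isSmoothingKernel e (δ := 1 / ((n : ℝ) + 1)) (by positivity)
  have hδ : Tendsto (fun n : ℕ => 1 / ((n : ℝ) + 1)) atTop (𝓝 0) :=
    tendsto_one_div_add_atTop_nhds_zero_nat
  set f : ℕ → E3 → ℝ := fun n => smoothing (η n) (a n) (t n) (V.indicator u) with hf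
  have hfc : ∀ n, ContDiff ℝ ∞ (f n) := fun n =>
    contDiff_smoothing (hη n).contDiff (hη n).hasCompactSupport huI.locallyIntegrable _ _
  have hD : ∀ n, ∀ α ∈ multiIndices m, ∀ x ∈ K, multiDeriv α (f n) x =
      t n ^ (∑ i, α i) * smoothing (η n) (a n) (t n) (G α) x := fun n α hα x hx =>
    multiDeriv_smoothing (hη n) huI.locallyIntegrable (hu.weakDeriv_spec hVo hα).1 hx
  have hKm : MeasurableSet K := (isCompact_closedCell e).measurableSet
  set E : ℕ → (Fin 3 → ℕ) → ℝ := fun n α => ∫ x in K, (multiDeriv α (f n) x - G α x) ^ 2 with hE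
  have hElim : ∀ α ∈ multiIndices m, Tendsto (fun n => E n α) atTop (𝓝 0) := by
    intro α hα
    refine (tendsto_integral_const_mul_smoothing hη hδ (hGI α hα) (hGL α hα)
      (∑ i, α i)).congr fun n => ?_
    refine setIntegral_congr_fun hKm fun x hx => ?_
    simp only [hD n α hα x hx]
  have hmemK : ∀ {g : E3 → ℝ}, Continuous g → MemLp g 2 (volume.restrict K) := fun hg =>
    memLp_of_continuousOn e hg.continuousOn
  have hbound : ∀ n, classicalNorm m K (f n) ≤ 3 * sobolevNorm m V u := by
    intro n
    -- The squared L² bound of the smoothing is 8, which is below 3².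
    refine (le_abs_self _).trans (abs_le_of_sq_le_sq ?_
      (mul_nonneg (by norm_num) (sobolevNorm_nonneg _ _ _)))
    rw [mul_pow, classicalNorm_sq, sobolevNorm_sq, Finset.mul_sum]
    refine Finset.sum_le_sum fun α hα => ?_
    have h1 := integral_smoothing_sq_le (hη n) (hGI α hα)
      ((memLp_two_iff_integrable_sq (hGL α hα).1).1 (hGL α hα))
    rw [hGsq] at h1
    have hc : Continuous (smoothing (η n) (a n) (t n) (G α)) :=
      (contDiff_smoothing (hη n).contDiff (hη n).hasCompactSupport
        (hGI α hα).locallyIntegrable _ _).continuous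
    have h2 : ∫ x in K, multiDeriv α (f n) x ^ 2 ≤
        ∫ x in K, smoothing (η n) (a n) (t n) (G α) x ^ 2 := by
      refine setIntegral_mono_on (integrableOn e
        ((contDiff_multiDeriv α (hfc n)).continuous.pow 2).continuousOn)
        (integrableOn e (hc.pow 2).continuousOn) hKm fun x hx => ?_
      rw [hD n α hα x hx, mul_pow]
      refine mul_le_of_le_one_left (sq_nonneg _) (pow_le_one₀ ?_ (pow_le_one₀ ?_ (hη n).le_one))
      · have := (hη n).half_le; positivity
      · linarith [(hη n).half_le]
    have h3 : 0 ≤ ∫ x in V, weakDeriv V α u x ^ 2 := integral_nonneg fun x => sq_nonneg _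
    linarith
  set c := taylorConst m (max 1 (Metric.diam K)) * Real.sqrt (vol e) / vol e with hc
  have hcpos : 0 ≤ c := div_nonneg (mul_nonneg (taylorConst_nonneg m (le_max_left _ _))
    (Real.sqrt_nonneg _)) (vol_pos e).le
  -- The Sobolev inequality for f n - f l turns convergence of all derivatives in L² into the
  -- uniform Cauchy property.
  have hdiff : ∀ n l, ∀ x ∈ K, |f n x - f l x| ≤ c * Real.sqrt (∑ α ∈ multiIndices m,
      2 * (E n α + E l α)) := by
    intro n l x hx
    have h1 := abs_le_classicalNorm e hm ((hfc n).sub (hfc l)) hx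
    rw [mul_comm, ← le_div_iff₀ (vol_pos e)] at h1
    have h2 : |f n x - f l x| ≤ c * classicalNorm m K (f n - f l) :=
      h1.trans (le_of_eq (by rw [hc, div_mul_eq_mul_div]; rfl))
    refine h2.trans (mul_le_mul_of_nonneg_left ?_ hcpos)
    refine Real.sqrt_le_sqrt (Finset.sum_le_sum fun α hα => ?_)
    rw [multiDeriv_sub α (hfc n) (hfc l)]
    exact integral_sub_sq_le (hmemK (contDiff_multiDeriv α (hfc n)).continuous)
      (hmemK (contDiff_multiDeriv α (hfc l)).continuous) ((hGL α hα).restrict K)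
  have hSlim : Tendsto (fun n => ∑ α ∈ multiIndices m, E n α) atTop (𝓝 0) := by
    simpa using tendsto_finsetSum (multiIndices m) fun α hα => hElim α hα
  have hcauchy : UniformCauchySeqOn f atTop K := by
    rw [Metric.uniformCauchySeqOn_iff]
    intro ε hε
    have hlim2 : Tendsto (fun z : ℕ × ℕ => c * Real.sqrt (2 * ((∑ α ∈ multiIndices m, E z.1 α) +
        ∑ α ∈ multiIndices m, E z.2 α))) (atTop ×ˢ atTop) (𝓝 0) := by
      have h1 : Tendsto (fun z : ℕ × ℕ => (∑ α ∈ multiIndices m, E z.1 α) +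
          ∑ α ∈ multiIndices m, E z.2 α) (atTop ×ˢ atTop) (𝓝 (0 + 0)) :=
        (hSlim.comp tendsto_fst).add (hSlim.comp tendsto_snd)
      have h2 := ((h1.const_mul 2).sqrt).const_mul c
      simpa using h2
    rw [prod_atTop_atTop_eq] at hlim2
    obtain ⟨⟨N, N'⟩, hN⟩ := eventually_atTop.1 (hlim2.eventually (gt_mem_nhds hε))
    refine ⟨max N N', fun n hn l hl x hx => ?_⟩
    rw [Real.dist_eq]
    refine (hdiff n l x hx).trans_lt ?_
    have := hN (n, l) ⟨(le_max_left _ _).trans hn, (le_max_right _ _).trans hl⟩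
    rwa [← Finset.mul_sum, Finset.sum_add_distrib]
  have hpt : ∀ x ∈ K, ∃ y, Tendsto (fun n => f n x) atTop (𝓝 y) := fun x hx =>
    cauchySeq_tendsto_of_complete (hcauchy.cauchySeq hx)
  choose! v hv using hpt
  have hunif : TendstoUniformlyOn f v atTop K := hcauchy.tendstoUniformlyOn_of_tendsto hv
  have hvc : ContinuousOn v K :=
    hunif.continuousOn (Frequently.of_forall fun n => (hfc n).continuous.continuousOn)
  refine ⟨f, v, hfc, hvc, ?_, hunif, hbound⟩
  have hvL : MemLp v 2 (volume.restrict K) := memLp_of_continuousOn e hvc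
  have hGK := (hGL 0 h0mem).restrict K
  have hvlim : Tendsto (fun n => ∫ x in K, (v x - f n x) ^ 2) atTop (𝓝 0) := by
    rw [Metric.tendsto_atTop]
    intro ε hε
    set b := Real.sqrt (ε / (2 * vol e)) with hb
    have hvp := vol_pos e
    have hb0 : 0 < b := Real.sqrt_pos.2 (by positivity)
    obtain ⟨N, hN⟩ := eventually_atTop.1 (Metric.tendstoUniformlyOn_iff.1 hunif b hb0)
    refine ⟨N, fun n hn => ?_⟩
    rw [dist_zero_right, Real.norm_of_nonneg (integral_nonneg fun x => sq_nonneg _)]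
    calc _ ≤ ∫ _ in K, b ^ 2 := by
          refine setIntegral_mono_on (integrableOn e
            ((hvc.sub (hfc n).continuous.continuousOn).pow 2)) (integrableOn e continuousOn_const)
            hKm fun x hx => ?_
          rw [← sq_abs]
          have := (hN n hn x hx).le
          rw [Real.dist_eq] at this
          gcongr
      _ = vol e * b ^ 2 := by simp [hK, vol]
      _ = ε / 2 := by rw [hb, Real.sq_sqrt (by positivity)]; field_simp
      _ < ε := by linarith
  -- The uniform limit v and u are both L² limits of f n, hence equal almost everywhere.
  have hzero : ∫ x in K, (v x - G 0 x) ^ 2 ≤ 0 := by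
    have hlim : Tendsto (fun n => 2 * ((∫ x in K, (v x - f n x) ^ 2) + E n 0)) atTop (𝓝 0) := by
      simpa using (hvlim.add (hElim 0 h0mem)).const_mul 2
    refine ge_of_tendsto' hlim fun n => ?_
    have := integral_sub_sq_le hvL hGK (hmemK (hfc n).continuous)
    refine this.trans (le_of_eq ?_)
    rw [hE]
    simp only [multiDeriv_zero]
    congr 2
    congr 1; funext x; ring
  have hae : (fun x => (v x - G 0 x) ^ 2) =ᵐ[volume.restrict K] 0 :=
    (integral_eq_zero_iff_of_nonneg (fun x => sq_nonneg _)
      ((memLp_two_iff_integrable_sq (hvL.sub hGK).1).1 (hvL.sub hGK))).1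
      (le_antisymm hzero (integral_nonneg fun x => sq_nonneg _))
  rw [hK, ← restrict_openCell] at hae
  filter_upwards [hae, hu.weakDeriv_zero hVo, ae_restrict_mem hVo.measurableSet] with x hx h0 hxV
  have : v x - G 0 x = 0 := by
    have : (v x - G 0 x) ^ 2 = 0 := hx
    exact pow_eq_zero_iff two_ne_zero |>.1 this
  rw [hG] at this
  simp only [indicator_of_mem hxV] at this
  linarith

/-- The choice in `contRep` is harmless: continuous representatives agree up to the boundary of the
cell. -/
lemma contRep_eqOn (e : Tetrahedron) {u v : E3 → ℝ} (hv : ContinuousOn v (closedCell e))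
    (h : v =ᵐ[volume.restrict (openCell e)] u) : EqOn (contRep e u) v (closedCell e) := by
  have hex : ∃ v : E3 → ℝ, ContinuousOn v (closedCell e) ∧
      v =ᵐ[volume.restrict (openCell e)] u := ⟨v, hv, h⟩
  rw [contRep, dif_pos hex]
  exact eqOn_of_ae_eq e hex.choose_spec.1 hv (hex.choose_spec.2.trans h.symm)

/-! ### Estimates of the integration error on one element -/

section

variable {ref : Tetrahedron} {Q : Finset E3} {wt : E3 → ℝ} {e : Tetrahedron}

lemma cellError_congr (hQ : ∀ x ∈ Q, x ∈ closedCell ref) {u u' w w' : E3 → ℝ}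
    (hu : EqOn u u' (closedCell e)) (hw : EqOn w w' (closedCell e)) :
    cellError ref Q wt e u w = cellError ref Q wt e u' w' := by
  rw [cellError, cellError]
  congr 1
  · exact setIntegral_congr_fun (isCompact_closedCell e).measurableSet fun x hx => by
      simp only [hu hx, hw hx]
  · congr 1
    refine Finset.sum_congr rfl fun x hx => ?_
    have := refMap_mem_closedCell (e := e).2 (hQ x hx)
    rw [hu this, hw this]

/-- Density: the error is continuous for the uniform norm in its first argument, with constant X
below, and the approximants have H^m norm at most three times that of u. -/
theorem abs_cellError_le (hQ : ∀ x ∈ Q, x ∈ closedCell ref)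
    (hwt : ∀ x ∈ Q, 0 < wt x) {m j n : ℕ} (hm : 2 ≤ m) (hj : j ≤ m) (hjn : j ≤ n + 1) {D : ℝ}
    (hD : 1 ≤ D) (hKD : Metric.diam (closedCell e) ≤ D) {u W : E3 → ℝ}
    (hu : MemH m (openCell e) u)
    (hW : ContinuousOn W (closedCell e)) {B : ℝ} (hB : ∀ x ∈ closedCell e, |W x| ≤ B)
    (hvan : ∀ q, IsPoly n q → cellError ref Q wt e q W = 0) :
    |cellError ref Q wt e (contRep e u) W| ≤
      (1 + (∑ x ∈ Q, wt x) / vol ref) * taylorConst m D *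
        Metric.diam (closedCell e) ^ j *
          (Real.sqrt (vol e) * B * (3 * sobolevNorm m (openCell e) u)) := by
  obtain ⟨f, v, hf, hv, hvu, hfv, hfN⟩ := hu.exists_smooth_approx e hm
  have hve := vol_pos e
  have hvr := vol_pos ref
  have hB0 : 0 ≤ B := by
    obtain ⟨x, hx⟩ := openCell_nonempty e
    exact (abs_nonneg _).trans (hB x (openCell_subset e hx))
  have hws : 0 ≤ ∑ x ∈ Q, wt x := Finset.sum_nonneg fun x hx => (hwt x hx).le
  rw [cellError_congr hQ (contRep_eqOn e hv hvu) (eqOn_refl W _)]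
  set X := B * (vol e + vol e / vol ref * ∑ x ∈ Q, wt x) with hX
  have hX0 : 0 ≤ X := by positivity
  refine le_of_forall_pos_le_add fun ε hε => ?_
  set b := ε / (X + 1) with hb
  have hb0 : 0 < b := by positivity
  obtain ⟨n₀, hn⟩ := (Metric.tendstoUniformlyOn_iff.1 hfv b hb0).exists
  have hfc := (hf n₀).continuous.continuousOn (s := closedCell e)
  have h1 := abs_cellError_le_of_contDiff hQ hwt hm hj hjn hD hKD (hf n₀) hW hB hvan
  have h2 := abs_cellError_le_sum (g := fun x => v x - f n₀ x) hQ hwt (hv.sub hfc) hW hB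
  rw [cellError_sub_left hv hfc hW] at h2
  have hd : ∀ x ∈ closedCell e, |v x - f n₀ x| ≤ b := fun x hx => by
    have := (hn x hx).le
    rwa [Real.dist_eq] at this
  have h3 : ∫ x in closedCell e, |v x - f n₀ x| ≤ vol e * b := by
    calc _ ≤ ∫ _ in closedCell e, b := setIntegral_mono_on (integrableOn e (hv.sub hfc).abs)
          (integrableOn e continuousOn_const) (isCompact_closedCell e).measurableSet hd
      _ = vol e * b := by simp [vol]
  have h4 : ∑ x ∈ Q, wt x * |v (refMap ref e x) - f n₀ (refMap ref e x)| ≤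
      (∑ x ∈ Q, wt x) * b := by
    rw [Finset.sum_mul]
    exact Finset.sum_le_sum fun x hx =>
      mul_le_mul_of_nonneg_left (hd _ (refMap_mem_closedCell.2 (hQ x hx))) (hwt x hx).le
  have h5 : |cellError ref Q wt e v W - cellError ref Q wt e (f n₀) W| ≤ ε := by
    calc _ ≤ _ := h2
      _ ≤ B * (vol e * b + vol e / vol ref * ((∑ x ∈ Q, wt x) * b)) := by gcongr
      _ = X * b := by rw [hX]; ring
      _ ≤ (X + 1) * b := by gcongr; linarith
      _ = ε := by rw [hb]; field_simp
  have h6 : |cellError ref Q wt e v W| ≤ |cellError ref Q wt e (f n₀) W| + ε := by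
    have := abs_sub_abs_le_abs_sub (cellError ref Q wt e v W) (cellError ref Q wt e (f n₀) W)
    linarith
  refine h6.trans (add_le_add (h1.trans ?_) le_rfl)
  have := taylorConst_nonneg m hD
  have h7 : 0 ≤ Metric.diam (closedCell e) := Metric.diam_nonneg
  gcongr
  exact hfN n₀

end

/-- Every derivative of W is again a polynomial of degree at most M, so the inverse inequality
compares the sup and L² norms of the same derivative; no derivative is traded for a power of h. -/
lemma exists_derivSum_le (ref : Tetrahedron) (M k : ℕ) : ∃ C : ℝ, 0 ≤ C ∧
    ∀ (e : Tetrahedron) (W : E3 → ℝ), IsPoly M W → ∀ x ∈ closedCell e,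
      Real.sqrt (vol e) * derivSum k W x ≤ C * classicalNorm k (closedCell e) W := by
  obtain ⟨C, hC, h⟩ := exists_inverse_inequality ref M
  refine ⟨(multiIndices k).card * C, by positivity, fun e W hW x hx => ?_⟩
  have hα : ∀ α, IsPoly M (multiDeriv α W) := fun α => by
    induction α using multiIndex_induction with
    | h0 => exact hW
    | hs α i ih => rw [multiDeriv_add_single α i hW.contDiff]; exact ih.partialDeriv i
  rw [derivSum, Finset.mul_sum, mul_assoc, ← nsmul_eq_mul]
  refine Finset.sum_le_card_nsmul _ _ _ fun α hmem => ?_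
  refine (h e _ (hα α) x hx).trans (mul_le_mul_of_nonneg_left (Real.sqrt_le_sqrt ?_) hC)
  exact Finset.single_le_sum (f := fun α => ∫ y in closedCell e, multiDeriv α W y ^ 2)
    (fun _ _ => integral_nonneg fun _ => sq_nonneg _) hmem

/-- The pointwise Taylor estimate: for the polynomial W sup bounds on derivatives are at hand, and
no averaging is needed. -/
lemma abs_sub_taylorSum_le_of_derivSum_le (m : ℕ) {f : E3 → ℝ} (hf : ContDiff ℝ ∞ f) {K : Set E3}
    (hK : IsCompact K) (hKc : Convex ℝ K) {S : ℝ} (hS : ∀ y ∈ K, derivSum (m + 1) f y ≤ S)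
    {x y : E3} (hx : x ∈ K) (hy : y ∈ K) :
    |f x - taylorSum (m + 1) f y (x - y)| ≤ (3 * Metric.diam K) ^ (m + 1) * S := by
  have h := sub_taylorSum_eq_integral m hf y (x - y)
  rw [add_sub_cancel] at h
  rw [h, ← Real.norm_eq_abs]
  have hv : ‖x - y‖ ≤ Metric.diam K := by
    rw [← dist_eq_norm]; exact Metric.dist_le_diam_of_mem hK.isBounded hx hy
  refine (intervalIntegral.norm_integral_le_of_norm_le_const fun s hs => ?_).trans
    (le_of_eq (by rw [sub_zero, abs_one, mul_one]))
  rw [uIoc_of_le zero_le_one] at hs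
  have hs0 : 0 ≤ 1 - s := by linarith [hs.2]
  have hmem : y + s • (x - y) ∈ K := by
    have := hKc hy hx hs0 hs.1.le (by ring)
    convert this using 1; module
  have hb := abs_dirPow_le (m := m + 1) (i := m + 1) (β := 0) (by simp) hf (y + s • (x - y)) (x - y)
  rw [multiDeriv_zero] at hb
  rw [norm_mul, norm_div, Real.norm_eq_abs, Real.norm_eq_abs, Real.norm_eq_abs,
    abs_of_nonneg (pow_nonneg hs0 _), Nat.abs_cast]
  calc _ ≤ 1 * |dirPow (m + 1) f (y + s • (x - y)) (x - y)| := by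
        gcongr
        · exact pow_le_one₀ hs0 (by linarith [hs.1])
        · exact div_le_self (abs_nonneg _)
            (by exact_mod_cast Nat.one_le_iff_ne_zero.2 (Nat.factorial_ne_zero _))
    _ ≤ (3 * ‖x - y‖) ^ (m + 1) * derivSum (m + 1) f (y + s • (x - y)) := by rw [one_mul]; exact hb
    _ ≤ _ := by
        have := derivSum_nonneg (m + 1) f (y + s • (x - y))
        gcongr
        exact hS _ hmem

section

variable (ref : Tetrahedron) {p M : ℕ} {U : Submodule ℝ Poly3} {Q : Finset E3} {wt : E3 → ℝ}

lemma mem_comp_sub {e : Tetrahedron} (hU : polySpace p ≤ U) {W q : E3 → ℝ}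
    (hW : ∃ G ∈ U, ∀ x, W (refMap ref e x) = polyEval G x) (hq : IsPoly p q) :
    ∃ G ∈ U, ∀ x, (W (refMap ref e x) - q (refMap ref e x)) = polyEval G x := by
  obtain ⟨G, hG, h⟩ := hW
  obtain ⟨F, hF, h'⟩ := hq.comp (isPoly_refMap ref e)
  exact ⟨G - F, U.sub_mem hG (hU hF), fun x => by
    rw [h, show q (refMap ref e x) = polyEval F x from h' x]; simp [polyEval]⟩

/-- The estimate of the integration error on one element, in terms of the `H¹` norm. -/
theorem exists_abs_cellError_le_one (hp : 2 ≤ p) (hU : polySpace p ≤ U)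
    (hexact : IsExactOnProducts ref Q wt (polySpace (p - 2)) U)
    (hQ : ∀ x ∈ Q, x ∈ closedCell ref) (hwt : ∀ x ∈ Q, 0 < wt x) {m : ℕ} (hm : 2 ≤ m)
    (hmp : m ≤ p) {D : ℝ} (hD : 1 ≤ D) : ∃ C : ℝ, 0 ≤ C ∧ ∀ e : Tetrahedron,
      Metric.diam (closedCell e) ≤ D → ∀ u W : E3 → ℝ, MemH m (openCell e) u → IsPoly M W →
      (∃ G ∈ U, ∀ x, W (refMap ref e x) = polyEval G x) →
      |cellError ref Q wt e (contRep e u) W| ≤ C * Metric.diam (closedCell e) ^ m *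
        (sobolevNorm m (openCell e) u * classicalNorm 1 (closedCell e) W) := by
  obtain ⟨c, hc, hS⟩ := exists_derivSum_le ref M 1
  have hws : 0 ≤ ∑ x ∈ Q, wt x := Finset.sum_nonneg fun x hx => (hwt x hx).le
  have hvr := vol_pos ref
  set A := (1 + (∑ x ∈ Q, wt x) / vol ref) * taylorConst m D * 3 with hA
  have hA0 : 0 ≤ A := by have := taylorConst_nonneg m hD; positivity
  -- 4 = 1 + 3, from the constant part and from the remainder of size 3 h S.
  refine ⟨4 * A * c, by positivity, fun e heD u W hu hW hWU => ?_⟩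
  have hve := vol_pos e
  have hsv : 0 < Real.sqrt (vol e) := Real.sqrt_pos.2 hve
  obtain ⟨y, hy⟩ := openCell_nonempty e
  replace hy := openCell_subset e hy
  obtain ⟨f, v, hf, hv, hvu, -⟩ := hu.exists_smooth_approx e hm
  have huc : ContinuousOn (contRep e u) (closedCell e) := hv.congr (contRep_eqOn e hv hvu)
  set h := Metric.diam (closedCell e) with hh
  have hh0 : 0 ≤ h := Metric.diam_nonneg
  set N := sobolevNorm m (openCell e) u
  have hN : 0 ≤ N := sobolevNorm_nonneg _ _ _
  set w := classicalNorm 1 (closedCell e) W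
  -- S bounds W and its first derivatives on e; the |e|^(1/2) in `abs_cellError_le` cancels its
  -- denominator.
  set S := c * w / Real.sqrt (vol e) with hSdef
  have hSle : ∀ x ∈ closedCell e, derivSum 1 W x ≤ S := fun x hx => by
    rw [hSdef, le_div_iff₀ hsv, mul_comm]; exact hS e W hW x hx
  have hsS : Real.sqrt (vol e) * S = c * w := by rw [hSdef]; field_simp
  set q : E3 → ℝ := fun x => taylorSum 1 W y (x - y) with hq
  have hqP : IsPoly 0 q := isPoly_taylorSum le_rfl W y
  set r : E3 → ℝ := fun x => W x - q x with hr
  have hqc := hqP.contDiff.continuous.continuousOn (s := closedCell e)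
  have hrc : ContinuousOn r (closedCell e) := hW.contDiff.continuous.continuousOn.sub hqc
  have hsplit : cellError ref Q wt e (contRep e u) W =
      cellError ref Q wt e (contRep e u) q + cellError ref Q wt e (contRep e u) r := by
    rw [← cellError_add_right huc hqc hrc]
    congr 1; funext x; rw [hr]; ring
  have hqB : ∀ x ∈ closedCell e, |q x| ≤ S := by
    intro x _
    have h1 := abs_dirPow_le (m := 1) (i := 0) (β := 0) (by simp) hW.contDiff y (x - y)
    rw [multiDeriv_zero, pow_zero, one_mul] at h1
    have h2 : q x = dirPow 0 W y (x - y) := by simp [hq, taylorSum]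
    rw [h2]; exact h1.trans (hSle y hy)
  have hrB : ∀ x ∈ closedCell e, |r x| ≤ (3 * h) ^ (0 + 1) * S := fun x hx =>
    abs_sub_taylorSum_le_of_derivSum_le 0 hW.contDiff (isCompact_closedCell e)
      (convex_closedCell e) hSle hx hy
  -- Against a constant, polynomials of degree m - 1 integrate exactly, which gains h^m. Against r,
  -- which pulls back into `U`, degree m - 2 ≤ p - 2 is available; this gains h^(m-1), and r
  -- supplies the missing h.
  have e1 := abs_cellError_le hQ hwt hm (j := m) (n := m - 1) le_rfl (by omega) hD heD hu hqc hqB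
    fun g hg => cellError_eq_zero_of_degree hU hexact (b := 0) (by omega) hg hqP
  have e2 := abs_cellError_le hQ hwt hm (j := m - 1) (n := m - 2) (by omega) (by omega) hD heD hu
    hrc hrB fun g hg => by
      obtain ⟨F, hF, hFe⟩ := (hg.mono (show m - 2 ≤ p - 2 by omega)).comp (isPoly_refMap ref e)
      obtain ⟨G, hG, hGe⟩ := mem_comp_sub ref hU hWU (hqP.mono (Nat.zero_le p))
      exact cellError_eq_zero_of_exact hexact hF hG hFe hGe
  have hpow : h ^ (m - 1) * h = h ^ m := by rw [← pow_succ]; congr 1; omega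
  rw [hsplit]
  refine (abs_add_le _ _).trans ((add_le_add e1 e2).trans (le_of_eq ?_))
  calc _ = A * h ^ m * N * (Real.sqrt (vol e) * S) +
        3 * A * (h ^ (m - 1) * h) * N * (Real.sqrt (vol e) * S) := by rw [hA]; ring
    _ = _ := by rw [hpow, hsS]; ring

/-- The estimate of the integration error on one element, in terms of the `H²` norm. -/
theorem exists_abs_cellError_le_two (hp : 2 ≤ p) (hU : polySpace p ≤ U)
    (hexact : IsExactOnProducts ref Q wt (polySpace (p - 2)) U)
    (hQ : ∀ x ∈ Q, x ∈ closedCell ref) (hwt : ∀ x ∈ Q, 0 < wt x) {m : ℕ} (hm : 2 ≤ m)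
    (hmp : m ≤ p + 1) {D : ℝ} (hD : 1 ≤ D) : ∃ C : ℝ, 0 ≤ C ∧ ∀ e : Tetrahedron,
      Metric.diam (closedCell e) ≤ D → ∀ u W : E3 → ℝ, MemH m (openCell e) u → IsPoly M W →
      (∃ G ∈ U, ∀ x, W (refMap ref e x) = polyEval G x) →
      |cellError ref Q wt e (contRep e u) W| ≤ C * Metric.diam (closedCell e) ^ m *
        (sobolevNorm m (openCell e) u * classicalNorm 2 (closedCell e) W) := by
  obtain ⟨c, hc, hS⟩ := exists_derivSum_le ref M 2
  have hws : 0 ≤ ∑ x ∈ Q, wt x := Finset.sum_nonneg fun x hx => (hwt x hx).le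
  have hvr := vol_pos ref
  set A := (1 + (∑ x ∈ Q, wt x) / vol ref) * taylorConst m D * 3 with hA
  have hA0 : 0 ≤ A := by have := taylorConst_nonneg m hD; positivity
  -- 13 = 1 + 3 + 9, from the constant part, the linear part of size 3 h S and the remainder of size
  -- (3 h)² S.
  refine ⟨13 * A * c, by positivity, fun e heD u W hu hW hWU => ?_⟩
  have hve := vol_pos e
  have hsv : 0 < Real.sqrt (vol e) := Real.sqrt_pos.2 hve
  obtain ⟨y, hy⟩ := openCell_nonempty e
  replace hy := openCell_subset e hy
  obtain ⟨f, v, hf, hv, hvu, -⟩ := hu.exists_smooth_approx e hm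
  have huc : ContinuousOn (contRep e u) (closedCell e) := hv.congr (contRep_eqOn e hv hvu)
  set h := Metric.diam (closedCell e) with hh
  have hh0 : 0 ≤ h := Metric.diam_nonneg
  set N := sobolevNorm m (openCell e) u
  have hN : 0 ≤ N := sobolevNorm_nonneg _ _ _
  set w := classicalNorm 2 (closedCell e) W
  set S := c * w / Real.sqrt (vol e) with hSdef
  have hSle : ∀ x ∈ closedCell e, derivSum 2 W x ≤ S := fun x hx => by
    rw [hSdef, le_div_iff₀ hsv, mul_comm]; exact hS e W hW x hx
  have hS0 : 0 ≤ S := (derivSum_nonneg 2 W y).trans (hSle y hy)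
  have hsS : Real.sqrt (vol e) * S = c * w := by rw [hSdef]; field_simp
  set q : E3 → ℝ := fun x => taylorSum 1 W y (x - y) with hq
  set l : E3 → ℝ := fun x => dirPow 1 W y (x - y) with hl
  have hqP : IsPoly 0 q := isPoly_taylorSum le_rfl W y
  have hlP : IsPoly 1 l := (isPoly_dirPow 1 W y).comp fun k =>
    (IsPoly.coord k).sub (IsPoly.const (y k))
  set s : E3 → ℝ := fun x => q x + l x with hs
  have hsP : IsPoly 1 s := (hqP.mono zero_le_one).add hlP
  set r : E3 → ℝ := fun x => W x - s x with hr
  have hqc := hqP.contDiff.continuous.continuousOn (s := closedCell e)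
  have hlc := hlP.contDiff.continuous.continuousOn (s := closedCell e)
  have hsc := hsP.contDiff.continuous.continuousOn (s := closedCell e)
  have hrc : ContinuousOn r (closedCell e) := hW.contDiff.continuous.continuousOn.sub hsc
  have hsplit : cellError ref Q wt e (contRep e u) W =
      cellError ref Q wt e (contRep e u) q + cellError ref Q wt e (contRep e u) l +
        cellError ref Q wt e (contRep e u) r := by
    rw [← cellError_add_right huc hqc hlc, ← cellError_add_right huc hsc hrc]
    congr 1; funext x; rw [hr]; ring
  have hqB : ∀ x ∈ closedCell e, |q x| ≤ S := by
    intro x _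
    have h1 := abs_dirPow_le (m := 2) (i := 0) (β := 0) (by simp) hW.contDiff y (x - y)
    rw [multiDeriv_zero, pow_zero, one_mul] at h1
    have h2 : q x = dirPow 0 W y (x - y) := by simp [hq, taylorSum]
    rw [h2]; exact h1.trans (hSle y hy)
  have hlB : ∀ x ∈ closedCell e, |l x| ≤ 3 * h * S := by
    intro x hx
    have h1 := abs_dirPow_le (m := 2) (i := 1) (β := 0) (by simp) hW.contDiff y (x - y)
    rw [multiDeriv_zero, pow_one] at h1
    have h2 : ‖x - y‖ ≤ h := by
      rw [← dist_eq_norm]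
      exact Metric.dist_le_diam_of_mem (isCompact_closedCell e).isBounded hx hy
    refine h1.trans ?_
    have := derivSum_nonneg 2 W y
    have := hSle y hy
    gcongr
  have hrB : ∀ x ∈ closedCell e, |r x| ≤ (3 * h) ^ (1 + 1) * S := fun x hx => by
    have h1 := abs_sub_taylorSum_le_of_derivSum_le 1 hW.contDiff (isCompact_closedCell e)
      (convex_closedCell e) hSle hx hy
    have h2 : s x = taylorSum (1 + 1) W y (x - y) := by
      simp [hs, hq, hl, taylorSum, Finset.sum_range_succ]
    rw [hr]; simp only [h2]; exact h1
  have e1 := abs_cellError_le hQ hwt hm (j := m) (n := m - 1) le_rfl (by omega) hD heD hu hqc hqB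
    fun g hg => cellError_eq_zero_of_degree hU hexact (b := 0) (by omega) hg hqP
  -- The product of the linear part with degree m - 2 has degree at most m - 1 ≤ p, so m = p + 1 is
  -- still allowed.
  have e2 := abs_cellError_le hQ hwt hm (j := m - 1) (n := m - 2) (by omega) (by omega) hD heD hu
    hlc hlB fun g hg => cellError_eq_zero_of_degree hU hexact (b := 1) (by omega) hg hlP
  -- For m = 2 truncated subtraction gives j = 0 and n = 0: nothing is subtracted from u, and
  -- exactness on constants holds anyway.
  have e3 := abs_cellError_le hQ hwt hm (j := m - 2) (n := m - 3) (by omega) (by omega) hD heD hu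
    hrc hrB fun g hg => by
      obtain ⟨F, hF, hFe⟩ := (hg.mono (show m - 3 ≤ p - 2 by omega)).comp (isPoly_refMap ref e)
      obtain ⟨G, hG, hGe⟩ := mem_comp_sub ref hU hWU (hsP.mono (by omega : 1 ≤ p))
      exact cellError_eq_zero_of_exact hexact hF hG hFe hGe
  have hpow : h ^ (m - 1) * h = h ^ m := by rw [← pow_succ]; congr 1; omega
  have hpow2 : h ^ (m - 2) * h ^ 2 = h ^ m := by rw [← pow_add]; congr 1; omega
  rw [hsplit]
  refine (abs_add_three _ _ _).trans ((add_le_add (add_le_add e1 e2) e3).trans (le_of_eq ?_))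
  calc _ = A * h ^ m * N * (Real.sqrt (vol e) * S) +
        3 * A * (h ^ (m - 1) * h) * N * (Real.sqrt (vol e) * S) +
        9 * A * (h ^ (m - 2) * h ^ 2) * N * (Real.sqrt (vol e) * S) := by rw [hA]; ring
    _ = _ := by rw [hpow, hpow2, hsS]; ring

end

/-! ### Summation over the elements -/

section

variable {Ω : Set E3} {T : Finset Tetrahedron}

/-- What the open cells miss lies in finitely many boundaries of convex sets, which are null. -/
lemma IsTessellation.ae_eq (hT : IsTessellation Ω T) :
    Ω =ᵐ[volume] ⋃ e ∈ T, openCell e := by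
  have hsub : ⋃ e ∈ T, openCell e ⊆ Ω := iUnion₂_subset hT.openCell_subset
  have hle : Ω ≤ᵐ[volume] ⋃ e ∈ T, openCell e := by
    have h1 : Ω \ ⋃ e ∈ T, openCell e ⊆ ⋃ e ∈ T, (closedCell e \ openCell e) := by
      rintro x ⟨hx, hn⟩
      have hx' : x ∈ ⋃ e ∈ T, closedCell e := by rw [hT.cover]; exact subset_closure hx
      simp only [mem_iUnion] at hx' hn ⊢
      obtain ⟨e, he, hxe⟩ := hx'
      exact ⟨e, he, hxe, fun h => hn ⟨e, he, h⟩⟩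
    rw [ae_le_set]
    refine measure_mono_null h1 ((measure_biUnion_null_iff T.countable_toSet).2 fun e _ => ?_)
    exact ae_le_set.1 (openCell_ae_eq e).symm.le
  exact hle.antisymm hsub.eventuallyLE

lemma IsTessellation.setIntegral_eq_sum (hT : IsTessellation Ω T) {F : E3 → ℝ}
    (hF : IntegrableOn F Ω) : ∫ x in Ω, F x = ∑ e ∈ T, ∫ x in openCell e, F x := by
  rw [setIntegral_congr_set hT.ae_eq]
  exact integral_biUnion_finset T (fun e _ => (isOpen_openCell e).measurableSet)
    (fun e he e' he' hne => hT.disjoint e he e' he' hne)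
    fun e he => hF.mono_set (hT.openCell_subset e he)

/-- A weak derivative on Ω restricts to the weak derivative on each cell, so the squared norms add
up. -/
lemma IsTessellation.sobolevNorm_sq (hT : IsTessellation Ω T) (hΩ : IsOpen Ω) {k : ℕ}
    {u : E3 → ℝ} (hu : MemH k Ω u) :
    ∑ e ∈ T, sobolevNorm k (openCell e) u ^ 2 = sobolevNorm k Ω u ^ 2 := by
  simp_rw [MassLumping.sobolevNorm_sq]
  rw [Finset.sum_comm]
  refine Finset.sum_congr rfl fun α hα => ?_
  obtain ⟨h1, h2⟩ := hu.weakDeriv_spec hΩ hα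
  rw [hT.setIntegral_eq_sum ((memLp_two_iff_integrable_sq h2.1).1 h2)]
  refine Finset.sum_congr rfl fun e he => ?_
  refine integral_congr_ae ?_
  filter_upwards [(weakDeriv_spec (isOpen_openCell e) (h1.mono (hT.openCell_subset e he))).2]
    with x hx
  rw [hx]

lemma IsTessellation.closedCell_subset (hT : IsTessellation Ω T) {e : Tetrahedron} (he : e ∈ T) :
    closedCell e ⊆ closure Ω := by
  rw [← hT.cover]; exact subset_biUnion_of_mem (u := fun e => closedCell e) he

lemma IsTessellation.diam_le_meshSize (hT : IsTessellation Ω T)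
    (hΩb : Bornology.IsBounded Ω) {e : Tetrahedron} (he : e ∈ T) :
    Metric.diam (closedCell e) ≤ meshSize T := by
  -- The set of admissible diameters must be nonempty, since the infimum of the empty set is 0 by
  -- convention; boundedness of Ω provides a member.
  refine le_csInf ?_ ?_
  · obtain ⟨R, hR⟩ := hΩb.closure.subset_closedBall (0 : E3)
    refine ⟨2 * max R 0, by positivity, fun e' he' => ⟨0, ?_⟩⟩
    rw [mul_div_cancel_left₀ _ two_ne_zero]
    exact (hT.closedCell_subset he').trans
      (hR.trans (Metric.closedBall_subset_closedBall (le_max_left _ _)))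
  · rintro d ⟨hd, h⟩
    obtain ⟨c, hc⟩ := h e he
    refine (Metric.diam_mono hc Metric.isBounded_closedBall).trans
      ((Metric.diam_closedBall (by positivity)).trans (le_of_eq (by ring)))

lemma IsTessellation.diam_le (hT : IsTessellation Ω T) (hΩb : Bornology.IsBounded Ω)
    {e : Tetrahedron} (he : e ∈ T) :
    Metric.diam (closedCell e) ≤ max 1 (Metric.diam (closure Ω)) :=
  (Metric.diam_mono (hT.closedCell_subset he) hΩb.closure).trans (le_max_right _ _)

lemma meshSize_nonneg (T : Finset Tetrahedron) : 0 ≤ meshSize T :=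
  Real.sInf_nonneg fun _ hd => hd.1

/-- The integration error is the sum of the integration errors on the elements. -/
lemma IsTessellation.integrationError_eq_sum (hT : IsTessellation Ω T) (hΩ : IsOpen Ω)
    {ref : Tetrahedron} {Q : Finset E3} {wt : E3 → ℝ} (hQ : ∀ x ∈ Q, x ∈ closedCell ref)
    {k : ℕ} (hk : 2 ≤ k) {u w : E3 → ℝ} (hu : MemH k Ω u) (hw : MemH 1 Ω w)
    {W : Tetrahedron → E3 → ℝ} (hWc : ∀ e ∈ T, Continuous (W e))
    (hW : ∀ e ∈ T, w =ᵐ[volume.restrict (openCell e)] W e) :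
    integrationError ref Q wt Ω T u w =
      ∑ e ∈ T, cellError ref Q wt e (contRep e u) (W e) := by
  have hint : IntegrableOn (fun x => u x * w x) Ω := (hu.memLp hΩ).integrable_mul (hw.memLp hΩ)
  rw [integrationError, discreteInner, hT.setIntegral_eq_sum hint, ← Finset.sum_sub_distrib]
  refine Finset.sum_congr rfl fun e he => ?_
  rw [cellError]
  obtain ⟨f, v, hf, hv, hvu, -⟩ :=
    (hu.mono_set (hT.openCell_subset e he)).exists_smooth_approx e hk
  have hcu := contRep_eqOn e hv hvu
  have hcw := contRep_eqOn e (hWc e he).continuousOn (hW e he).symm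
  congr 1
  · rw [← restrict_openCell]
    refine integral_congr_ae ?_
    filter_upwards [hW e he, hvu, ae_restrict_mem (isOpen_openCell e).measurableSet]
      with x h1 h2 h3
    rw [h1, hcu (Tetrahedron.openCell_subset e h3), h2]
  · congr 1
    refine Finset.sum_congr rfl fun x hx => ?_
    rw [hcw (refMap_mem_closedCell.2 (hQ x hx))]

end

end MassLumping

end

/-! ### The uniform constant and the global estimates. -/

theorem mainTheorem3
    (ref : MassLumping.Tetrahedron)
    (p p' : ℕ) (hp : 2 ≤ p)
    (Uplus : Submodule ℝ MassLumping.Poly3) (hUplus : Uplus ≤ MassLumping.polySpace p')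
    (Q : Finset MassLumping.E3)
    (hQ : ∀ x ∈ Q, x ∈ MassLumping.Tetrahedron.closedCell ref)
    (wt : MassLumping.E3 → ℝ) (hwt : ∀ x ∈ Q, 0 < wt x)
    (hexact : MassLumping.IsExactOnProducts ref Q wt
      (MassLumping.polySpace (p - 2)) (MassLumping.polySpace p ⊔ Uplus))
    (Ω : Set MassLumping.E3) (hΩ : IsOpen Ω) (hΩb : Bornology.IsBounded Ω)
    (σ : ℝ) :
    ∃ C : ℝ, 0 < C ∧
      ∀ T : Finset MassLumping.Tetrahedron,
        MassLumping.IsTessellation Ω T → MassLumping.IsShapeRegular σ T →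
      ∀ k : ℕ, 2 ≤ k →
      ∀ u w : MassLumping.E3 → ℝ, MassLumping.MemH k Ω u →
        MassLumping.MemFESpace ref (MassLumping.polySpace p ⊔ Uplus) Ω T w →
        |MassLumping.integrationError ref Q wt Ω T u w| ≤
            C * MassLumping.meshSize T ^ (min p k) *
              MassLumping.sobolevNorm (min p k) Ω u * MassLumping.sobolevNorm 1 Ω w ∧
        |MassLumping.integrationError ref Q wt Ω T u w| ≤
            C * MassLumping.meshSize T ^ (min (p + 1) k) *
              MassLumping.sobolevNorm (min (p + 1) k) Ω u * MassLumping.brokenNorm 2 T w := by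
  open MassLumping Tetrahedron in
  set U := polySpace p ⊔ Uplus with hUdef
  have hU : polySpace p ≤ U := le_sup_left
  have hUM : U ≤ polySpace (max p p') :=
    sup_le (polySpace_mono (le_max_left _ _)) (hUplus.trans (polySpace_mono (le_max_right _ _)))
  set D := max 1 (Metric.diam (closure Ω)) with hD
  have hD1 : 1 ≤ D := le_max_left _ _
  have ex1 := fun m : ℕ => fun h : 2 ≤ m ∧ m ≤ p =>
    exists_abs_cellError_le_one ref (M := max p p') hp hU hexact hQ hwt h.1 h.2 hD1
  have ex2 := fun m : ℕ => fun h : 2 ≤ m ∧ m ≤ p + 1 =>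
    exists_abs_cellError_le_two ref (M := max p p') hp hU hexact hQ hwt h.1 h.2 hD1
  choose! C₁ hC₁ hE₁ using ex1
  choose! C₂ hC₂ hE₂ using ex2
  set I := Finset.Icc 2 (p + 1) with hI
  -- The order m = min(p, k) or min(p + 1, k) takes finitely many values, so the constant is uniform
  -- in k. Absolute values are needed because `C₁ (p + 1)` is an arbitrary default.
  set C := 1 + ∑ m ∈ I, (|C₁ m| + |C₂ m|) with hC
  have hCle : ∀ m, 2 ≤ m → m ≤ p + 1 → C₁ m ≤ C ∧ C₂ m ≤ C := by
    intro m h1 h2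
    have h3 := Finset.single_le_sum (f := fun m => |C₁ m| + |C₂ m|) (s := I)
      (fun _ _ => by positivity) (Finset.mem_Icc.2 ⟨h1, h2⟩)
    have := le_abs_self (C₁ m)
    have := le_abs_self (C₂ m)
    have := abs_nonneg (C₁ m)
    have := abs_nonneg (C₂ m)
    constructor <;> linarith
  have hC0 : 0 < C := by positivity
  refine ⟨C, hC0, fun T hT _ k hk u w hu hw => ?_⟩
  obtain ⟨hw1, hwU⟩ := hw
  choose! q hqU hqw using hwU
  -- The polynomial on the whole space that represents w on e, in physical coordinates.
  set W : Tetrahedron → E3 → ℝ := fun e y => polyEval (q e) (refMap e ref y) with hW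
  have hWref : ∀ e ∈ T, ∃ G ∈ U, ∀ x, W e (refMap ref e x) = polyEval G x := fun e he =>
    ⟨q e, hqU e he, fun x => by simp only [hW, refMap_refMap]⟩
  have hWpoly : ∀ e ∈ T, IsPoly (max p p') (W e) := fun e he =>
    IsPoly.comp (f := polyEval (q e)) ⟨q e, hUM (hqU e he), fun _ => rfl⟩ (isPoly_refMap e ref)
  have hWw : ∀ e ∈ T, w =ᵐ[volume.restrict (openCell e)] W e := fun e he => by
    refine ae_openCell_of_refMap ref e (P := fun y => w y = W e y) ?_
    filter_upwards [hqw e he] with x hx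
    rw [hx]; simp only [hW, refMap_refMap]
  have hWnorm : ∀ e ∈ T, ∀ l, sobolevNorm l (openCell e) w = classicalNorm l (closedCell e) (W e) := by
    intro e he l
    obtain ⟨g, hg, -⟩ := hw1 0 (mem_multiIndices.2 (by simp))
    exact sobolevNorm_eq_classicalNorm e (hg.1.mono_set (hT.openCell_subset e he))
      (hWpoly e he).contDiff (hWw e he)
  have hsum := hT.integrationError_eq_sum hΩ (wt := wt) hQ hk hu hw1
    (fun e he => (hWpoly e he).contDiff.continuous) hWw
  have hmesh := meshSize_nonneg T
  -- Both estimates have this form, with l = 1 and l = 2; the sum over elements is Cauchy-Schwarz.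
  have main : ∀ (m l : ℕ) (c : ℝ), m ≤ k → c ≤ C → (∀ e ∈ T,
      |cellError ref Q wt e (contRep e u) (W e)| ≤ c * Metric.diam (closedCell e) ^ m *
        (sobolevNorm m (openCell e) u * classicalNorm l (closedCell e) (W e))) →
      |integrationError ref Q wt Ω T u w| ≤ C * meshSize T ^ m * sobolevNorm m Ω u *
        brokenNorm l T w := by
    intro m l c hmk hcC hcell
    have huN : Real.sqrt (∑ e ∈ T, sobolevNorm m (openCell e) u ^ 2) = sobolevNorm m Ω u := by
      rw [hT.sobolevNorm_sq hΩ (hu.mono_order hmk), Real.sqrt_sq (sobolevNorm_nonneg _ _ _)]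
    have hCS := Real.sum_mul_le_sqrt_mul_sqrt T (fun e => sobolevNorm m (openCell e) u)
      (fun e => sobolevNorm l (openCell e) w)
    rw [huN] at hCS
    rw [hsum]
    calc _ ≤ ∑ e ∈ T, |cellError ref Q wt e (contRep e u) (W e)| := Finset.abs_sum_le_sum_abs _ _
      _ ≤ ∑ e ∈ T, C * meshSize T ^ m *
          (sobolevNorm m (openCell e) u * sobolevNorm l (openCell e) w) := by
          refine Finset.sum_le_sum fun e he => (hcell e he).trans ?_
          rw [hWnorm e he]
          have h1 := hT.diam_le_meshSize hΩb he
          have h2 : 0 ≤ Metric.diam (closedCell e) := Metric.diam_nonneg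
          have h3 := sobolevNorm_nonneg m (openCell e) u
          have h4 := classicalNorm_nonneg l (closedCell e) (W e)
          gcongr
      _ = C * meshSize T ^ m * ∑ e ∈ T,
          sobolevNorm m (openCell e) u * sobolevNorm l (openCell e) w := by rw [Finset.mul_sum]
      _ ≤ C * meshSize T ^ m * (sobolevNorm m Ω u * brokenNorm l T w) := by
          gcongr; exact hCS
      _ = _ := by ring
  have hcellH : ∀ e ∈ T, ∀ m ≤ k, MemH m (openCell e) u := fun e he m hm =>
    (hu.mono_order hm).mono_set (hT.openCell_subset e he)
  -- Membership of w in H¹(Ω) makes the broken norm of order one a global norm.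
  have hb1 : brokenNorm 1 T w = sobolevNorm 1 Ω w := by
    rw [brokenNorm, hT.sobolevNorm_sq hΩ hw1, Real.sqrt_sq (sobolevNorm_nonneg _ _ _)]
  constructor
  · have h2 : 2 ≤ min p k := le_min hp hk
    rw [← hb1]
    exact main (min p k) 1 _ (min_le_right _ _) (hCle _ h2 (by omega)).1 fun e he =>
      hE₁ _ ⟨h2, min_le_left _ _⟩ e (hT.diam_le hΩb he) u (W e)
        (hcellH e he _ (min_le_right _ _)) (hWpoly e he) (hWref e he)
  · have h2 : 2 ≤ min (p + 1) k := le_min (by omega) hk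
    exact main (min (p + 1) k) 2 _ (min_le_right _ _) (hCle _ h2 (min_le_left _ _)).2 fun e he =>
      hE₂ _ ⟨h2, min_le_left _ _⟩ e (hT.diam_le hΩb he) u (W e)
        (hcellH e he _ (min_le_right _ _)) (hWpoly e he) (hWref e he)
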